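/- An instance of \textsc{Binary Weighted Vertex Integrity} consists of a finite simple graph $G=(V,E)$, positive integer vertex weights $w\colon V\to\mathbb{Z}^{+}$, and an integer $k$, where $G$ is given by its adjacency matrix and the numbers are encoded in binary. The question is whether $\mathrm{wvi}(G)\le k$, where \[ \mathrm{wvi}(G)=\min_{S\subseteq V}\Big\{w(S)+\max_{C\in\mathrm{cc}(G-S)}w(V(C))\Big\},\qquad w(X)=\sum_{v\in X}w(v), \] $\mathrm{cc}(G-S)$ is the set of connected components of $G-S$, and the maximum over the empty set is $0$. Two vertices $u,v$ are twins in $G$ if $N(u)\setminus\{v\}=N(v)\setminus\{u\}$. The twin cover number $\mathrm{tc}(G)$ is the minimum size of a set $C\subseteq V$ such that each connected component of $G-C$ is a set of pairwise twin vertices of $G$. \textsc{Binary Weighted Vertex Integrity} is fixed-parameter tractable parameterized by twin cover number: there are an algorithm, a computable function $f\colon\mathbb{N}\to\mathbb{N}$ and a polynomial $p$ such that, on every instance $(G,w,k)$ whose encoding has length $L$, the algorithm correctly decides whether $\mathrm{wvi}(G)\le k$ in at most $f(\mathrm{tc}(G))\cdot p(L)$ steps. (The algorithm runs on a random access machine with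 addition, truncated subtraction and halving at unit cost, with the encoding given as a bit string.) -/

import Mathlib

/-! ### A random access machine with uniform costs

The machine works on finitely many memory banks (those named in the program). Each bank is an
infinite array of cells indexed by `ℕ`, and each cell holds a natural number. The arithmetic
operations are addition, truncated subtraction and halving, and every elementary instruction costs
one step. In one step the bit length of the largest number in memory grows by at most a constant
that depends on the program, so these machines and multitape Turing machines simulate each other
with polynomial overhead. -/

namespace RAM

/-- The content of the memory: `s a i` is the number in cell `i` of bank `a`. -/
abbrev Memory := ℕ → ℕ → ℕ

/-- Arithmetic expressions. `cell a e` is the content of the cell of bank `a` whose index is the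
value of `e` (indirect addressing). -/
inductive Expr : Type
  | num (m : ℕ) : Expr
  | cell (a : ℕ) (e : Expr) : Expr
  | add (e₁ e₂ : Expr) : Expr
  | sub (e₁ e₂ : Expr) : Expr
  | half (e : Expr) : Expr

/-- The value of an expression. -/
def Expr.eval (s : Memory) : Expr → ℕ
  | .num m => m
  | .cell a e => s a (e.eval s)
  | .add e₁ e₂ => e₁.eval s + e₂.eval s
  | .sub e₁ e₂ => e₁.eval s - e₂.eval s
  | .half e => e.eval s / 2

/-- Programs. `assign a i e` writes the value of `e` into the cell of bank `a` whose index is the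
value of `i`; tests succeed when the value of the tested expression is not zero. -/
inductive Program : Type
  | nop : Program
  | assign (a : ℕ) (i e : Expr) : Program
  | seq (p q : Program) : Program
  | ite (e : Expr) (p q : Program) : Program
  | loop (e : Expr) (p : Program) : Program

/-- The memory after `v` has been written into cell `i` of bank `a`. -/
def Memory.write (s : Memory) (a i v : ℕ) : Memory :=
  Function.update s a (Function.update (s a) i v)

/-- `Runs p s t s'`: the program `p`, started with memory `s`, terminates after exactly `t` steps
with memory `s'`. An assignment, an empty instruction and each evaluation of a test take one
step. -/
inductive Runs : Program → Memory → ℕ → Memory → Prop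
  | nop (s : Memory) : Runs .nop s 1 s
  | assign (a : ℕ) (i e : Expr) (s : Memory) :
      Runs (.assign a i e) s 1 (s.write a (i.eval s) (e.eval s))
  | seq {p q : Program} {s s' s'' : Memory} {t t' : ℕ} :
      Runs p s t s' → Runs q s' t' s'' → Runs (.seq p q) s (t + t') s''
  | ite_true {e : Expr} {p q : Program} {s s' : Memory} {t : ℕ} :
      e.eval s ≠ 0 → Runs p s t s' → Runs (.ite e p q) s (t + 1) s'
  | ite_false {e : Expr} {p q : Program} {s s' : Memory} {t : ℕ} :
      e.eval s = 0 → Runs q s t s' → Runs (.ite e p q) s (t + 1) s'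
  | loop_true {e : Expr} {p : Program} {s s' s'' : Memory} {t t' : ℕ} :
      e.eval s ≠ 0 → Runs p s t s' → Runs (.loop e p) s' t' s'' →
        Runs (.loop e p) s (t + t' + 1) s''
  | loop_false {e : Expr} {p : Program} {s : Memory} :
      e.eval s = 0 → Runs (.loop e p) s 1 s

/-- The initial memory on the input word `x`: cell `0` of bank `0` holds the length of `x`, the
first cells of bank `1` hold the bits of `x`, and all other cells hold `0`. -/
def Memory.init (x : List Bool) : Memory := fun a i =>
  if a = 0 ∧ i = 0 then x.length
  else if a = 1 then (x.getD i false).toNat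
  else 0

/-- A final memory is accepting if cell `0` of bank `0` does not hold `0`. -/
def Memory.Accepting (s : Memory) : Prop := s 0 0 ≠ 0

end RAM

/-- A decision problem with set of instances `I`, encoded as binary words by `enc`, with
yes-instances `Q` and parameter `κ`, is fixed-parameter tractable: some program decides it, and on
every instance `x` it takes at most `f (κ x) * p (|enc x|)` steps, for a computable function `f`
and a polynomial `p`. The program gets only `enc x`, not the value of the parameter. -/
def FixedParameterTractable {I : Type} (enc : I → List Bool) (Q : I → Prop) (κ : I → ℕ) : Prop :=
  ∃ (P : RAM.Program) (f : ℕ → ℕ) (p : Polynomial ℕ), Computable f ∧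
    ∀ x : I, ∃ (t : ℕ) (s : RAM.Memory),
      RAM.Runs P (RAM.Memory.init (enc x)) t s ∧
      t ≤ f (κ x) * p.eval (enc x).length ∧
      (s.Accepting ↔ Q x)

/-! ### Weighted vertex integrity and twin cover number -/

namespace VertexIntegrity

/-- The weight of a set of vertices. -/
def weight {V : Type} (w : V → ℕ+) (X : Finset V) : ℕ := ∑ v ∈ X, (w v : ℕ)

/-- The graph `G - S`. -/
abbrev deleteSet {V : Type} (G : SimpleGraph V) (S : Finset V) : SimpleGraph {v : V // v ∉ S} :=
  G.induce {v : V | v ∉ S}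

open Classical in
/-- The vertex set of a connected component of `G - S`, as a set of vertices of `G`. -/
noncomputable def componentVertices {V : Type} [Fintype V] (G : SimpleGraph V) (S : Finset V)
    (C : (deleteSet G S).ConnectedComponent) : Finset V :=
  Finset.univ.filter fun v => ∃ h : v ∉ S, (⟨v, h⟩ : {v : V // v ∉ S}) ∈ C.supp

/-- The maximum weight of a connected component of `G - S` (it is `0` if `G - S` has no vertices).
The supremum is over a finite set. -/
noncomputable def maxComponentWeight {V : Type} [Fintype V] (G : SimpleGraph V) (w : V → ℕ+)
    (S : Finset V) : ℕ :=
  ⨆ C : (deleteSet G S).ConnectedComponent, weight w (componentVertices G S C)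

/-- The weighted vertex integrity; an infimum of natural numbers over a nonempty index set is a
minimum. -/
noncomputable def wvi {V : Type} [Fintype V] (G : SimpleGraph V) (w : V → ℕ+) : ℕ :=
  ⨅ S : Finset V, (weight w S + maxComponentWeight G w S)

/-- `u` and `v` are twins: they have the same neighborhood except for themselves. -/
def Twins {V : Type} (G : SimpleGraph V) (u v : V) : Prop :=
  G.neighborSet u \ {v} = G.neighborSet v \ {u}

/-- `C` is a twin cover: each connected component of `G - C` is a set of twin vertices in `G`. -/
def IsTwinCover {V : Type} (G : SimpleGraph V) (C : Finset V) : Prop :=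
  ∀ K : (deleteSet G C).ConnectedComponent, ∀ u ∈ K.supp, ∀ v ∈ K.supp, Twins G u.1 v.1

/-- The twin cover number: the minimum size of a twin cover (the set of all vertices is one). -/
noncomputable def twinCoverNumber {V : Type} (G : SimpleGraph V) : ℕ :=
  sInf {m : ℕ | ∃ C : Finset V, IsTwinCover G C ∧ C.card = m}

/-- An instance: a graph on `n` vertices with positive integral weights, and an integer `k`. -/
structure Instance : Type where
  n : ℕ
  graph : SimpleGraph (Fin n)
  w : Fin n → ℕ+
  k : ℤ

/-- The question: is the weighted vertex integrity at most `k`? -/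
def Instance.IsYes (x : Instance) : Prop := (wvi x.graph x.w : ℤ) ≤ x.k

/-- The parameter: the twin cover number of the underlying unweighted graph. -/
noncomputable def Instance.tc (x : Instance) : ℕ := twinCoverNumber x.graph

/-- The binary code of a natural number, made self-delimiting: each binary digit (least significant
first) is preceded by `1`, and the code ends with `0`. -/
def encodeNat (m : ℕ) : List Bool := m.bits.flatMap (fun b => [true, b]) ++ [false]

open Classical in
/-- The rows of the adjacency matrix, one after the other. -/
noncomputable def encodeGraph {n : ℕ} (G : SimpleGraph (Fin n)) : List Bool :=
  (List.finRange n).flatMap fun i => (List.finRange n).map fun j => decide (G.Adj i j)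

/-- The binary word of an instance: the number of vertices in unary, the adjacency matrix, the
weights in binary, the sign of `k`, and the absolute value of `k` in binary. -/
noncomputable def Instance.encode (x : Instance) : List Bool :=
  (List.replicate x.n true ++ [false]) ++ encodeGraph x.graph ++
    ((List.finRange x.n).flatMap fun i => encodeNat (x.w i)) ++
    (decide (x.k < 0) :: encodeNat x.k.natAbs)

end VertexIntegrity

/-! ### Hoare-style rules with step bounds for the machine -/

namespace RAM

/-! Call a deleted set S separating if each of its vertices has neighbours in two different
components of G - S. An optimal S may be assumed separating: if all neighbours of some v in S that
lie outside S belong to one component, then putting v back lowers w(S) by w(v) and raises the weight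
of a component by at most w(v) (`IsSolution.erase`, `IsSolution.exists_separating`).

Let the border of u be the set of x in N[u] with N[x] ≠ N[u]. A separating S is a union of classes
of vertices with equal border (`Separating.mem_of_border_eq`). Indeed, let v in S have neighbours x,
y in different components of G - S. Then x and y are not adjacent, so each of them distinguishes the
closed neighbourhood of the other from N[v], and both lie in the border of v. If u has the same
border, then x and y lie in N[u], and u outside S would join their components.

There are few classes. If C is a twin cover, a vertex outside C has the same closed neighbourhood as
each of its neighbours outside C, so its border is a subset of C (`IsTwinCover.border_subset`).
Hence there are at most tc + 2 ^ tc borders (`card_le_of_injOn_border`), and at most 2 ^ (tc + 2 ^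
tc) unions of classes. The program computes the classes in polynomial time directly from the
adjacency matrix, tries every union and checks each by graph search. Neither a twin cover nor the
value of the parameter is needed; they enter only the analysis of the running time.

The rest is program verification: `Ends` bounds the number of steps and states a postcondition at
once, and `Runs.frame` supplies the unchanged banks. -/

@[simp] theorem Memory.write_apply_self (s : Memory) (a i v : ℕ) :
    s.write a i v a = Function.update (s a) i v := by
  simp [Memory.write]

theorem Memory.write_apply_of_ne (s : Memory) {a b : ℕ} (h : b ≠ a) (i v : ℕ) :
    s.write a i v b = s b := by
  simp [Memory.write, h]

/-- The banks that a program may write to. -/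
def Program.writes : Program → List ℕ
  | .nop => []
  | .assign a _ _ => [a]
  | .seq p q => p.writes ++ q.writes
  | .ite _ p q => p.writes ++ q.writes
  | .loop _ p => p.writes

/-- The frame rule. Since `Program.writes` is computed from the syntax, specifications need to
mention only what a program changes; everything else follows from list membership, mostly by
`decide`. -/
theorem Runs.frame {p : Program} {s s' : Memory} {t : ℕ} (h : Runs p s t s') :
    ∀ a ∉ p.writes, s' a = s a := by
  induction h with
  | nop s => intros; rfl
  | assign b i e s =>
    intro a ha
    exact Memory.write_apply_of_ne s (by simpa [Program.writes] using ha) _ _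
  | seq _ _ ih₁ ih₂ =>
    intro a ha
    simp only [Program.writes, List.mem_append, not_or] at ha
    rw [ih₂ a ha.2, ih₁ a ha.1]
  | ite_true _ _ ih =>
    intro a ha
    simp only [Program.writes, List.mem_append, not_or] at ha
    exact ih a ha.1
  | ite_false _ _ ih =>
    intro a ha
    simp only [Program.writes, List.mem_append, not_or] at ha
    exact ih a ha.2
  | loop_true _ _ _ ih₁ ih₂ =>
    intro a ha
    rw [ih₂ a ha, ih₁ a ha]
  | loop_false _ => intros; rfl

/-- The program `p`, started with memory `s`, ends after at most `T` steps with a memory that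
satisfies `Q`. -/
def Ends (p : Program) (s : Memory) (T : ℕ) (Q : Memory → Prop) : Prop :=
  ∃ t s', Runs p s t s' ∧ t ≤ T ∧ Q s'

namespace Ends

variable {p q : Program} {s : Memory} {T T' : ℕ} {Q Q' : Memory → Prop}

theorem mono (h : Ends p s T Q) (hT : T ≤ T')
    (hQ : ∀ s', (∀ a ∉ p.writes, s' a = s a) → Q s' → Q' s') : Ends p s T' Q' := by
  obtain ⟨t, s', hr, ht, hq⟩ := h
  exact ⟨t, s', hr, ht.trans hT, hQ s' hr.frame hq⟩

theorem of_le (h : Ends p s T Q) (hT : T ≤ T') : Ends p s T' Q :=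
  h.mono hT fun _ _ => id

theorem imp (h : Ends p s T Q) (hQ : ∀ s', (∀ a ∉ p.writes, s' a = s a) → Q s' → Q' s') :
    Ends p s T Q' :=
  h.mono le_rfl hQ

theorem nop (h : Q s) : Ends .nop s 1 Q :=
  ⟨1, s, .nop s, le_rfl, h⟩

theorem assign {a : ℕ} {i e : Expr} (h : Q (s.write a (i.eval s) (e.eval s))) :
    Ends (.assign a i e) s 1 Q :=
  ⟨1, _, .assign a i e s, le_rfl, h⟩

theorem seq (h : Ends p s T Q)
    (h' : ∀ s', (∀ a ∉ p.writes, s' a = s a) → Q s' → Ends q s' T' Q') :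
    Ends (.seq p q) s (T + T') Q' := by
  obtain ⟨t, s', hr, ht, hq⟩ := h
  obtain ⟨t', s'', hr', ht', hq'⟩ := h' s' hr.frame hq
  exact ⟨t + t', s'', hr.seq hr', by omega, hq'⟩

theorem assign_seq {a : ℕ} {i e : Expr}
    (h : Ends q (s.write a (i.eval s) (e.eval s)) T Q) :
    Ends (.seq (.assign a i e) q) s (1 + T) Q :=
  (Ends.assign (Q := (· = _)) rfl).seq fun _ _ hs => hs ▸ h

theorem ite {e : Expr} (h₁ : e.eval s ≠ 0 → Ends p s T Q) (h₂ : e.eval s = 0 → Ends q s T Q) :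
    Ends (.ite e p q) s (T + 1) Q := by
  by_cases he : e.eval s = 0
  · obtain ⟨t, s', hr, ht, hq⟩ := h₂ he
    exact ⟨t + 1, s', .ite_false he hr, by omega, hq⟩
  · obtain ⟨t, s', hr, ht, hq⟩ := h₁ he
    exact ⟨t + 1, s', .ite_true he hr, by omega, hq⟩

theorem loop_false {e : Expr} (he : e.eval s = 0) (h : Q s) : Ends (.loop e p) s 1 Q :=
  ⟨1, s, .loop_false he, le_rfl, h⟩

theorem loop_true {e : Expr} (he : e.eval s ≠ 0)
    (h : Ends p s T fun s' => Ends (.loop e p) s' T' Q) :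
    Ends (.loop e p) s (T + T' + 1) Q := by
  obtain ⟨t, s', hr, ht, t', s'', hr', ht', hq⟩ := h
  exact ⟨t + t' + 1, s'', .loop_true he hr hr', by omega, hq⟩

end Ends

/-- The value of cell `0` of bank `a`. -/
def Expr.var (a : ℕ) : Expr := .cell a (.num 0)

/-- A number that is `0` exactly if `e₁` and `e₂` have the same value. -/
def Expr.dist (e₁ e₂ : Expr) : Expr := .add (.sub e₁ e₂) (.sub e₂ e₁)

@[simp] theorem Expr.eval_num (s : Memory) (m : ℕ) : (Expr.num m).eval s = m := rfl

@[simp] theorem Expr.eval_var (s : Memory) (a : ℕ) : (Expr.var a).eval s = s a 0 := rfl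

@[simp] theorem Expr.eval_cell (s : Memory) (a : ℕ) (e : Expr) :
    (Expr.cell a e).eval s = s a (e.eval s) := rfl

@[simp] theorem Expr.eval_add (s : Memory) (e₁ e₂ : Expr) :
    (Expr.add e₁ e₂).eval s = e₁.eval s + e₂.eval s := rfl

@[simp] theorem Expr.eval_sub (s : Memory) (e₁ e₂ : Expr) :
    (Expr.sub e₁ e₂).eval s = e₁.eval s - e₂.eval s := rfl

@[simp] theorem Expr.eval_half (s : Memory) (e : Expr) :
    (Expr.half e).eval s = e.eval s / 2 := rfl

@[simp] theorem Expr.eval_dist_eq_zero (s : Memory) (e₁ e₂ : Expr) :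
    (Expr.dist e₁ e₂).eval s = 0 ↔ e₁.eval s = e₂.eval s := by
  simp only [Expr.dist, Expr.eval_add, Expr.eval_sub]
  omega

/-- Assignment to cell `0` of bank `a`. -/
def Program.set (a : ℕ) (e : Expr) : Program := .assign a (.num 0) e

/-- Conditional execution. -/
def Program.when (e : Expr) (p : Program) : Program := .ite e p .nop

/-- Execute `p` with `0, 1, …` in cell `0` of bank `i`, as long as this counter is less than the
content of cell `0` of bank `b`. -/
def Program.forLoop (i b : ℕ) (p : Program) : Program :=
  .seq (.set i (.num 0))
    (.loop (.sub (.var b) (.var i)) (.seq p (.set i (.add (.var i) (.num 1)))))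

namespace Ends

variable {p q : Program} {s : Memory} {T T' : ℕ} {Q Q' : Memory → Prop}

theorem set {a : ℕ} {e : Expr} (h : Q (s.write a 0 (e.eval s))) : Ends (.set a e) s 1 Q :=
  Ends.assign h

theorem set_seq {a : ℕ} {e : Expr} (h : Ends q (s.write a 0 (e.eval s)) T Q) :
    Ends (.seq (.set a e) q) s (1 + T) Q :=
  Ends.assign_seq h

theorem when {e : Expr} (hT : 1 ≤ T) (h₁ : e.eval s ≠ 0 → Ends p s T Q)
    (h₂ : e.eval s = 0 → Q s) :
    Ends (.when e p) s (T + 1) Q :=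
  Ends.ite h₁ fun h => (Ends.nop (h₂ h)).of_le hT

/-- The rule for counting loops. -/
theorem forLoop {i b n N : ℕ} (hn : s b 0 = n) (hN : n ≤ N) (hi : i ∉ p.writes) (hb : b ∉ p.writes)
    (hib : b ≠ i) (inv : ℕ → Memory → Prop) (h0 : inv 0 (s.write i 0 0))
    (hstep : ∀ j < n, ∀ s' : Memory, s' i 0 = j →
      (∀ a ∉ i :: p.writes, s' a = s a) → inv j s' →
      Ends p s' T fun s'' => inv (j + 1) (s''.write i 0 (j + 1))) :
    Ends (.forLoop i b p) s (N * (T + 2) + 2) (inv n) := by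
  -- Induction on the number m of remaining iterations. Each costs T for the body, one step for the
  -- test and one for the increment; the last failing test and the initialization of the counter
  -- give the extra 2. The bound N replaces n at the end, so that costs depend on the input length
  -- only.
  have key : ∀ m j : ℕ, j + m = n → ∀ s' : Memory, s' i 0 = j →
      (∀ a ∉ i :: p.writes, s' a = s a) → inv j s' →
      Ends (.loop (.sub (.var b) (.var i)) (.seq p (.set i (.add (.var i) (.num 1))))) s'
        (m * (T + 2) + 1) (inv n) := by
    intro m
    induction m with
    | zero =>
      intro j hj s' hs hf hinv
      have hbs : s' b = s b := hf b (by simp [hib, hb])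
      obtain rfl : j = n := by omega
      refine (Ends.loop_false ?_ hinv).of_le (by omega)
      simp [hs, hbs, hn]
    | succ m ih =>
      intro j hj s' hs hf hinv
      have hbs : s' b = s b := hf b (by simp [hib, hb])
      refine (Ends.loop_true (T := T + 1) (T' := m * (T + 2) + 1) ?_ ?_).of_le (by ring_nf; omega)
      · simp [hs, hbs, hn]; omega
      refine (hstep j (by omega) s' hs hf hinv).seq fun s'' hf' hinv' => Ends.set ?_
      have hi'' : s'' i 0 = j := by rw [hf' i hi, hs]
      simp only [Expr.eval_add, Expr.eval_var, Expr.eval_num, hi'']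
      refine ih (j + 1) (by omega) _ (by simp) (fun a ha => ?_) hinv'
      rw [Memory.write_apply_of_ne _ (by simp at ha; exact ha.1), hf' a (by simp at ha; exact ha.2),
        hf a ha]
  refine (set_seq (T := n * (T + 2) + 1) (key n 0 (by omega) _ (by simp) (fun a ha => ?_) h0)).of_le ?_
  · exact Memory.write_apply_of_ne _ (by simp at ha; exact ha.1) _ _
  · have := Nat.mul_le_mul_right (T + 2) hN
    omega

end Ends

end RAM

/-! ### Tables filled by three nested loops -/

namespace RAM

/-- The entry in row `i` and column `j` of the matrix in bank `a`; bank `4` holds the offsets of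
the rows. -/
def Expr.entry (a : ℕ) (i j : Expr) : Expr := .cell a (.add (.cell 4 i) j)

@[simp] theorem Expr.eval_entry (s : Memory) (a : ℕ) (i j : Expr) :
    (Expr.entry a i j).eval s = s a (s 4 (i.eval s) + j.eval s) := rfl

/-- For all `i, j, l` below the number in bank `2`, write `e` into entry `(i, j)` of bank `b` if
`c` holds. The numbers `i, j, l` are in the banks `21, 22, 23`. -/
def table (b : ℕ) (c e : Expr) : Program :=
  .forLoop 21 2 (.forLoop 22 2 (.forLoop 23 2
    (.when c (.assign b (.add (.cell 4 (.var 21)) (.var 22)) e))))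

/-- The program never writes a default value, so bank `b` has to be zero at the start; `hrow` says
that different entries occupy different cells, so that no write disturbs another entry. -/
theorem ends_table {b : ℕ} {c e : Expr} {s : Memory} {n L : ℕ} (hn : s 2 0 = n) (hL : n ≤ L)
    (hrow : ∀ i < n, ∀ j < n, ∀ i' < n, ∀ j' < n, s 4 i + j = s 4 i' + j' → i = i' ∧ j = j')
    (hb2 : 2 ≠ b) (hb4 : 4 ≠ b) (hb21 : 21 ≠ b) (hb22 : 22 ≠ b) (hb23 : 23 ≠ b)
    (h0 : ∀ a, s b a = 0) {C : ℕ → ℕ → ℕ → Prop} {E : ℕ → ℕ → ℕ}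
    (hc : ∀ s' : Memory, (∀ a, a ≠ 21 → a ≠ 22 → a ≠ 23 → a ≠ b → s' a = s a) →
      s' 21 0 < n → s' 22 0 < n → s' 23 0 < n →
      (c.eval s' ≠ 0 ↔ C (s' 21 0) (s' 22 0) (s' 23 0)))
    (he : ∀ s' : Memory, (∀ a, a ≠ 21 → a ≠ 22 → a ≠ 23 → a ≠ b → s' a = s a) →
      s' 21 0 < n → s' 22 0 < n → e.eval s' = E (s' 21 0) (s' 22 0)) :
    Ends (table b c e) s (L * (L * (L * 4 + 4) + 4) + 2) fun s' => ∀ i < n, ∀ j < n,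
      ((∃ l < n, C i j l) → s' b (s 4 i + j) = E i j) ∧
      (¬ (∃ l < n, C i j l) → s' b (s 4 i + j) = 0) := by
  -- X is the set of triples processed so far. All three loops share this invariant, with X an
  -- initial segment of the lexicographic order; entering or leaving a loop only rewrites X.
  let inv (X : ℕ → ℕ → ℕ → Prop) (s' : Memory) : Prop := ∀ i < n, ∀ j < n,
      ((∃ l < n, X i j l ∧ C i j l) → s' b (s 4 i + j) = E i j) ∧
      (¬ (∃ l < n, X i j l ∧ C i j l) → s' b (s 4 i + j) = 0)
  have hinv : ∀ (X Y : ℕ → ℕ → ℕ → Prop) (s' s'' : Memory), s' b = s'' b →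
      (∀ i < n, ∀ j < n, ∀ l < n, X i j l ↔ Y i j l) → inv X s' → inv Y s'' := by
    intro X Y s' s'' hs h hX i hi j hj
    have : (∃ l < n, Y i j l ∧ C i j l) ↔ ∃ l < n, X i j l ∧ C i j l := by
      constructor
      · rintro ⟨l, hl, h1, h2⟩; exact ⟨l, hl, (h i hi j hj l hl).2 h1, h2⟩
      · rintro ⟨l, hl, h1, h2⟩; exact ⟨l, hl, (h i hi j hj l hl).1 h1, h2⟩
    rw [this, ← hs]
    exact hX i hi j hj
  have w : ∀ (s' : Memory) (a v : ℕ), a ≠ b → s'.write a 0 v b = s' b :=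
    fun s' a v h => Memory.write_apply_of_ne _ h.symm _ _
  refine Ends.imp (Q := inv fun i j l => i < n) ?_ ?_
  swap
  · intro s' _ h i hi j hj
    have := h i hi j hj
    simpa [hi] using this
  refine (Ends.forLoop (T := L * (L * 4 + 4) + 2) hn hL ?_ ?_ (by decide)
    (fun i₀ => inv fun i j l => i < i₀) ?_ ?_)
  · simp [Program.forLoop, Program.when, Program.set, Program.writes, hb21]
  · simp [Program.forLoop, Program.when, Program.set, Program.writes, hb2]
  · intro i _ j _
    simp [w _ _ _ hb21, h0]
  intro i₀ hi₀ s₁ hs₁ hf₁ hinv₁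
  have f₁ : ∀ a, a ≠ 21 → a ≠ 22 → a ≠ 23 → a ≠ b → s₁ a = s a := by
    intro a h1 h2 h3 h4
    exact hf₁ a (by simp [Program.forLoop, Program.when, Program.set, Program.writes, *])
  refine (Ends.forLoop (T := L * 4 + 2) (n := n) ?_ hL ?_ ?_ (by decide)
    (fun j₀ => inv fun i j l => i < i₀ ∨ i = i₀ ∧ j < j₀) ?_ ?_).imp ?_
  · rw [f₁ 2 (by decide) (by decide) (by decide) hb2, hn]
  · simp [Program.forLoop, Program.when, Program.set, Program.writes, hb22]
  · simp [Program.forLoop, Program.when, Program.set, Program.writes, hb2]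
  · refine hinv _ _ _ _ (w _ _ _ hb22).symm ?_ hinv₁
    simp
  swap
  · intro s' _ h
    refine hinv _ _ _ _ (w _ _ _ hb21).symm ?_ h
    intros; omega
  intro j₀ hj₀ s₂ hs₂ hf₂ hinv₂
  have f₂ : ∀ a, a ≠ 22 → a ≠ 23 → a ≠ b → s₂ a = s₁ a := by
    intro a h2 h3 h4
    exact hf₂ a (by simp [Program.forLoop, Program.when, Program.set, Program.writes, *])
  refine (Ends.forLoop (T := 2) (n := n) ?_ hL ?_ ?_ (by decide)
    (fun l₀ => inv fun i j l => i < i₀ ∨ i = i₀ ∧ (j < j₀ ∨ j = j₀ ∧ l < l₀)) ?_ ?_).imp ?_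
  · rw [f₂ 2 (by decide) (by decide) hb2, f₁ 2 (by decide) (by decide) (by decide) hb2, hn]
  · simp [Program.when, Program.writes, hb23]
  · simp [Program.when, Program.writes, hb2]
  · refine hinv _ _ _ _ (w _ _ _ hb23).symm ?_ hinv₂
    simp
  swap
  · intro s' _ h
    refine hinv _ _ _ _ (w _ _ _ hb22).symm ?_ h
    intros; omega
  intro l₀ hl₀ s₃ hs₃ hf₃ hinv₃
  have f₃ : ∀ a, a ≠ 21 → a ≠ 22 → a ≠ 23 → a ≠ b → s₃ a = s a := by
    intro a h1 h2 h3 h4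
    rw [hf₃ a (by simp [Program.when, Program.writes, *]), f₂ a h2 h3 h4, f₁ a h1 h2 h3 h4]
  have e21 : s₃ 21 0 = i₀ := by
    rw [hf₃ 21 (by simp [Program.when, Program.writes, hb21]), f₂ 21 (by decide) (by decide) hb21,
      hs₁]
  have e22 : s₃ 22 0 = j₀ := by
    rw [hf₃ 22 (by simp [Program.when, Program.writes, hb22]), hs₂]
  have e4 : s₃ 4 = s 4 := f₃ 4 (by decide) (by decide) (by decide) hb4
  have hc' := hc s₃ f₃ (by omega) (by omega) (by omega)
  rw [e21, e22, hs₃] at hc'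
  have he' := he s₃ f₃ (by omega) (by omega)
  rw [e21, e22] at he'
  refine Ends.when le_rfl (fun h => Ends.assign ?_) fun h => ?_
  · have hC := hc'.1 h
    refine hinv (fun i j l => i < i₀ ∨ i = i₀ ∧ (j < j₀ ∨ j = j₀ ∧ l < l₀ + 1)) _ _ _
      (w _ _ _ hb23).symm (by simp) ?_
    intro i hi j hj
    simp only [Memory.write_apply_self, he', Expr.eval_add, Expr.eval_cell, Expr.eval_var, e21, e22,
      e4]
    by_cases hij : i = i₀ ∧ j = j₀
    · obtain ⟨rfl, rfl⟩ := hij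
      have : ∃ l < n, (i < i ∨ i = i ∧ (j < j ∨ j = j ∧ l < l₀ + 1)) ∧ C i j l :=
        ⟨l₀, hl₀, by simp, hC⟩
      exact ⟨fun _ => by simp, fun h => absurd this h⟩
    · rw [Function.update_of_ne]
      · have h1 : ∀ l, (i < i₀ ∨ i = i₀ ∧ (j < j₀ ∨ j = j₀ ∧ l < l₀ + 1)) ↔
            (i < i₀ ∨ i = i₀ ∧ (j < j₀ ∨ j = j₀ ∧ l < l₀)) := by intro l; omega
        simp only [h1]
        exact hinv₃ i hi j hj
      · intro h'
        exact hij (hrow i hi j hj i₀ hi₀ j₀ hj₀ h')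
  · have hC : ¬ C i₀ j₀ l₀ := fun h' => hc'.2 h' h
    intro i hi j hj
    rw [w _ _ _ hb23]
    have h1 : (∃ l < n, (i < i₀ ∨ i = i₀ ∧ (j < j₀ ∨ j = j₀ ∧ l < l₀ + 1)) ∧ C i j l) ↔
        ∃ l < n, (i < i₀ ∨ i = i₀ ∧ (j < j₀ ∨ j = j₀ ∧ l < l₀)) ∧ C i j l := by
      refine exists_congr fun l => and_congr_right fun _ => and_congr_left fun hCl => ?_
      by_cases h2 : i = i₀ ∧ j = j₀ ∧ l = l₀
      · obtain ⟨rfl, rfl, rfl⟩ := h2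
        exact absurd hCl hC
      · omega
    rw [h1]
    exact hinv₃ i hi j hj

end RAM

/-! ### Class representatives, and decoding numbers into unions of classes -/

namespace RAM

/-- Bank `12` receives, for each row `i` of the matrix in bank `11`, the number `j + 1` for some
`j < i` such that entry `(i, j)` is `0`, if there is one; bank `13` receives the power of `2` whose
exponent is the number of rows without such a `j`. -/
def representatives : Program :=
  .seq (.set 13 (.num 1)) <| .forLoop 21 2 <| .seq
    (.forLoop 22 2 (.when (.sub (.var 21) (.var 22))
      (.ite (.entry 11 (.var 21) (.var 22)) .nop
        (.assign 12 (.var 21) (.add (.var 22) (.num 1))))))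
    (.ite (.cell 12 (.var 21)) .nop (.set 13 (.add (.var 13) (.var 13))))

/-- `r i` is `0` if `i` is not related to a smaller number, and the successor of a related smaller
number otherwise. -/
def Represents (R : ℕ → ℕ → Prop) (n : ℕ) (r : ℕ → ℕ) : Prop :=
  ∀ i < n, (r i = 0 ∧ ∀ j < i, ¬ R i j) ∨ ∃ j < i, r i = j + 1 ∧ R i j

open Classical in
-- Any related smaller index will do, so later values of j may overwrite earlier ones. That index
-- need not be a representative itself: decoding goes through the vertices in increasing order and
-- copies a value that is already final.
theorem ends_representatives {s : Memory} {n L : ℕ} (hn : s 2 0 = n) (hL : n ≤ L)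
    {R : ℕ → ℕ → Prop} (hR : ∀ i < n, ∀ j < n, s 11 (s 4 i + j) = 0 ↔ R i j)
    (h0 : ∀ a, s 12 a = 0) :
    Ends representatives s (1 + (L * (L * 5 + 6) + 2)) fun s' =>
      Represents R n (s' 12) ∧ s' 13 0 = 2 ^ Nat.count (fun i => ∀ j < i, ¬ R i j) n := by
  refine Ends.set_seq ?_
  refine (Ends.forLoop (T := L * 5 + 4) (n := n) ?_ hL (by decide) (by decide) (by decide)
    (fun i s' => Represents R i (s' 12) ∧ (∀ a, i ≤ a → s' 12 a = 0) ∧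
      s' 13 0 = 2 ^ Nat.count (fun i => ∀ j < i, ¬ R i j) i) ?_ ?_).imp
    fun s' _ h => ⟨h.1, h.2.2⟩
  · simp [Memory.write_apply_of_ne, hn]
  · refine ⟨fun i hi => absurd hi (Nat.not_lt_zero i), fun a _ => ?_, ?_⟩
    · simp [Memory.write_apply_of_ne, h0]
    · simp [Memory.write_apply_of_ne]
  rintro i hi s₁ hs₁ hf₁ ⟨hr, hz, hp⟩
  have e₁ : ∀ a, a ≠ 12 → a ≠ 13 → a ≠ 21 → a ≠ 22 → s₁ a = s a := by
    intro a h1 h2 h3 h4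
    rw [hf₁ a (by simp [Program.forLoop, Program.when, Program.set, Program.writes, *])]
    exact Memory.write_apply_of_ne _ h2 _ _
  refine (Ends.seq (T := L * (3 + 2) + 2) (T' := 2)
    (Q := fun s' => s' 13 0 = s₁ 13 0 ∧ (∀ a, a ≠ i → s' 12 a = s₁ 12 a) ∧
      ((s' 12 i = 0 ∧ ∀ j < i, ¬ R i j) ∨ ∃ j < i, s' 12 i = j + 1 ∧ R i j))
    ((Ends.forLoop (T := 3) (n := n) ?_ hL (by decide) (by decide) (by decide)
    (fun j s' => s' 13 0 = s₁ 13 0 ∧ (∀ a, a ≠ i → s' 12 a = s₁ 12 a) ∧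
      ((s' 12 i = 0 ∧ ∀ j' < i, j' < j → ¬ R i j') ∨ ∃ j < i, s' 12 i = j + 1 ∧ R i j))
      ?_ ?_).imp ?_) ?_).of_le (by omega)
  · rw [e₁ 2 (by decide) (by decide) (by decide) (by decide), hn]
  · simp [Memory.write_apply_of_ne, hz]
  · rintro j hj s₂ hs₂ hf₂ ⟨h13, h12, hi'⟩
    have f4 : s₂ 4 = s 4 := by
      rw [hf₂ 4 (by decide), e₁ 4 (by decide) (by decide) (by decide) (by decide)]
    have f11 : s₂ 11 = s 11 := by
      rw [hf₂ 11 (by decide), e₁ 11 (by decide) (by decide) (by decide) (by decide)]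
    have f21 : s₂ 21 0 = i := by rw [hf₂ 21 (by decide), hs₁]
    refine Ends.when (by decide) (fun hji => Ends.ite (T := 1) (fun hne => Ends.nop ?_)
      (fun heq => Ends.assign ?_)) fun hji => ?_
    · simp only [Expr.eval_entry, Expr.eval_var, f4, f11, f21, hs₂, ne_eq, hR i hi j hj] at hne
      simp only [Memory.write_apply_of_ne, ne_eq, Nat.reduceEqDiff, not_false_eq_true]
      refine ⟨h13, h12, hi'.imp_left fun h => ⟨h.1, fun j' h1 h2 => ?_⟩⟩
      rcases Nat.lt_succ_iff_lt_or_eq.1 h2 with h2 | rfl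
      exacts [h.2 j' h1 h2, hne]
    · simp only [Expr.eval_entry, Expr.eval_var, f4, f11, f21, hs₂, hR i hi j hj] at heq
      simp only [Expr.eval_sub, Expr.eval_var, f21, hs₂] at hji
      simp only [Memory.write_apply_of_ne, ne_eq, Nat.reduceEqDiff, not_false_eq_true,
        Memory.write_apply_self, Expr.eval_var, Expr.eval_add, Expr.eval_num, f21, hs₂]
      refine ⟨h13, fun a ha => ?_, Or.inr ⟨j, by omega, by simp, heq⟩⟩
      rw [Function.update_of_ne ha, h12 a ha]
    · simp only [Expr.eval_sub, Expr.eval_var, f21, hs₂] at hji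
      simp only [Memory.write_apply_of_ne, ne_eq, Nat.reduceEqDiff, not_false_eq_true]
      exact ⟨h13, h12, hi'.imp_left fun h => ⟨h.1, fun j' h1 h2 => h.2 j' h1 (by omega)⟩⟩
  · rintro s' _ ⟨h1, h2, h3⟩
    exact ⟨h1, h2, h3.imp_left fun h => ⟨h.1, fun j hj => h.2 j hj (by omega)⟩⟩
  · rintro s₂ hf₂ ⟨h13, h12, hi'⟩
    have f21 : s₂ 21 0 = i := by rw [hf₂ 21 (by decide), hs₁]
    have hr' : Represents R (i + 1) (s₂ 12) := by
      intro k hk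
      rcases Nat.lt_succ_iff_lt_or_eq.1 hk with hk | rfl
      · rw [h12 k hk.ne]; exact hr k hk
      · exact hi'
    have hz' : ∀ a, i + 1 ≤ a → s₂ 12 a = 0 := fun a ha => by rw [h12 a (by omega), hz a (by omega)]
    refine Ends.ite (fun h => Ends.nop ?_) fun h => Ends.set ?_
    · simp only [Memory.write_apply_of_ne, ne_eq, Nat.reduceEqDiff, not_false_eq_true]
      refine ⟨hr', hz', ?_⟩
      simp only [Expr.eval_cell, Expr.eval_var, f21] at h
      obtain ⟨j, hj, -, hRj⟩ := hi'.resolve_left fun h' => h h'.1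
      rw [Nat.count_succ, if_neg (fun h' => h' j hj hRj), h13, hp, add_zero]
    · simp only [Memory.write_apply_of_ne, ne_eq, Nat.reduceEqDiff, not_false_eq_true,
        Memory.write_apply_self, Expr.eval_add, Expr.eval_var, Function.update_self]
      refine ⟨hr', hz', ?_⟩
      simp only [Expr.eval_cell, Expr.eval_var, f21] at h
      have h' : ∀ j < i, ¬ R i j := by
        rcases hi' with h' | ⟨j, -, h', -⟩
        · exact h'.2
        · omega
      rw [Nat.count_succ, if_pos h', h13, hp, pow_succ, mul_two]

/-- Turn the number in bank `20` into a subset of the vertices, in bank `14`. -/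
def decode : Program :=
  .seq (.set 19 (.var 20)) <| .forLoop 21 2 <| .ite (.cell 12 (.var 21))
    (.assign 14 (.var 21) (.cell 14 (.sub (.cell 12 (.var 21)) (.num 1))))
    (.seq (.assign 14 (.var 21) (.sub (.var 19) (.add (.half (.var 19)) (.half (.var 19)))))
      (.set 19 (.half (.var 19))))

/-- `x` is the indicator function that the number `m` encodes: the numbers `v` with `r v = 0` use up
the binary digits of `m`, the others copy the value at `r v - 1`. -/
def Decodes (r : ℕ → ℕ) (m n : ℕ) (x : ℕ → ℕ) : Prop :=
  ∀ v < n, x v = if r v = 0 then m / 2 ^ Nat.count (fun i => r i = 0) v % 2 else x (r v - 1)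

theorem ends_decode {s : Memory} {n L : ℕ} (hn : s 2 0 = n) (hL : n ≤ L)
    (hr : ∀ v < n, s 12 v ≤ v) :
    Ends decode s (1 + (L * 5 + 2)) fun s' => Decodes (s 12) (s 20 0) n (s' 14) := by
  refine Ends.set_seq ?_
  refine (Ends.forLoop (T := 3) (n := n) ?_ hL (by decide) (by decide) (by decide)
    (fun i s' => s' 19 0 = s 20 0 / 2 ^ Nat.count (fun i => s 12 i = 0) i ∧
      Decodes (s 12) (s 20 0) i (s' 14)) ?_ ?_).imp fun s' _ h => h.2
  · simp [Memory.write_apply_of_ne, hn]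
  · exact ⟨by simp [Memory.write_apply_of_ne], fun i hi => absurd hi (Nat.not_lt_zero i)⟩
  rintro i hi s₁ hs₁ hf₁ ⟨hm, hd⟩
  have e12 : s₁ 12 = s 12 := by
    rw [hf₁ 12 (by decide), Memory.write_apply_of_ne _ (by decide)]
  have key : ∀ x : ℕ → ℕ, (∀ v < i, x v = s₁ 14 v) →
      (x i = if s 12 i = 0 then s 20 0 / 2 ^ Nat.count (fun i => s 12 i = 0) i % 2
        else x (s 12 i - 1)) → Decodes (s 12) (s 20 0) (i + 1) x := by
    intro x hx hxi v hv
    rcases Nat.lt_succ_iff_lt_or_eq.1 hv with hv | rfl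
    · rw [hx v hv, hd v hv]
      split_ifs with h
      · rfl
      · have := hr v (by omega)
        rw [hx _ (by omega)]
    · exact hxi
  refine Ends.ite (T := 2) (fun h => (Ends.assign ?_).of_le (by decide)) fun h =>
    Ends.assign_seq (Ends.set ?_)
  · simp only [Expr.eval_cell, Expr.eval_var, hs₁, e12] at h
    simp only [Memory.write_apply_of_ne, ne_eq, Nat.reduceEqDiff, not_false_eq_true,
      Memory.write_apply_self, Expr.eval_cell, Expr.eval_sub, Expr.eval_num, Expr.eval_var, hs₁, e12]
    refine ⟨by rw [hm, Nat.count_succ, if_neg h, add_zero], key _ (fun v hv => ?_) ?_⟩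
    · rw [Function.update_of_ne hv.ne]
    · have := hr i hi
      rw [if_neg h, Function.update_self, Function.update_of_ne (by omega)]
  · simp only [Expr.eval_cell, Expr.eval_var, hs₁, e12] at h
    simp only [Memory.write_apply_of_ne, ne_eq, Nat.reduceEqDiff, not_false_eq_true,
      Memory.write_apply_self, Expr.eval_half, Expr.eval_add, Expr.eval_sub, Expr.eval_var, hs₁,
      Function.update_self]
    refine ⟨?_, key _ (fun v hv => ?_) ?_⟩
    · rw [hm, Nat.count_succ, if_pos h, pow_succ, Nat.div_div_eq_div_mul]
    · rw [Function.update_of_ne hv.ne]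
    -- The machine has no remainder operation; the last digit of m is m - (m / 2 + m / 2).
    · rw [if_pos h, Function.update_self, hm]
      omega

/-- Bank `d` receives the sum of the numbers of bank `5` at the nonzero places of bank `x`. -/
def sumOver (d x : ℕ) : Program :=
  .seq (.set d (.num 0)) <| .forLoop 21 2 <|
    .when (.cell x (.var 21)) (.set d (.add (.var d) (.cell 5 (.var 21))))

theorem ends_sumOver {d x : ℕ} (h2 : 2 ≠ d) (h5 : 5 ≠ d) (h21 : 21 ≠ d) (hx21 : x ≠ 21)
    (hxd : x ≠ d) {s : Memory} {n L : ℕ} (hn : s 2 0 = n) (hL : n ≤ L) :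
    Ends (sumOver d x) s (1 + (L * 4 + 2)) fun s' =>
      s' d 0 = ∑ v ∈ Finset.range n, if s x v ≠ 0 then s 5 v else 0 := by
  refine Ends.set_seq ?_
  refine Ends.forLoop (T := 2) (n := n) ?_ hL ?_ ?_ (by decide)
    (fun i s' => s' d 0 = ∑ v ∈ Finset.range i, if s x v ≠ 0 then s 5 v else 0) ?_ ?_
  · simp [Memory.write_apply_of_ne, hn, h2]
  · simp [Program.when, Program.set, Program.writes, h21]
  · simp [Program.when, Program.set, Program.writes, h2]
  · simp [Memory.write_apply_of_ne, h21.symm]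
  intro i hi s₁ hs₁ hf₁ hinv
  have e5 : s₁ 5 = s 5 := by
    rw [hf₁ 5 (by simp [Program.when, Program.set, Program.writes, h5]),
      Memory.write_apply_of_ne _ h5]
  have ex : s₁ x = s x := by
    rw [hf₁ x (by simp [Program.when, Program.set, Program.writes, hxd, hx21]),
      Memory.write_apply_of_ne _ hxd]
  refine Ends.when le_rfl (fun h => Ends.set ?_) fun h => ?_
  · simp only [Expr.eval_cell, Expr.eval_var, hs₁, ex] at h
    rw [Memory.write_apply_of_ne _ h21.symm]
    simp only [Expr.eval_cell, Expr.eval_var, hs₁, Expr.eval_add, Memory.write_apply_self,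
      Function.update_self, hinv, e5, Finset.sum_range_succ, if_pos h]
  · simp only [Expr.eval_cell, Expr.eval_var, hs₁, ex] at h
    rw [Memory.write_apply_of_ne _ h21.symm]
    simp [Finset.sum_range_succ, hinv, h]

end RAM

/-! ### Graph search, verification of a candidate set, exhaustive search -/

namespace RAM

/-- One step to a neighbour outside of the deleted set, the set of places where `x` is nonzero. -/
def Step (n : ℕ) (A : ℕ → ℕ → Prop) (x : ℕ → ℕ) (u v : ℕ) : Prop :=
  u < n ∧ v < n ∧ A u v ∧ x v = 0

/-- Reachability in at most `r` steps. -/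
def Within (st : ℕ → ℕ → Prop) (a : ℕ) : ℕ → ℕ → Prop
  | 0, v => v = a
  | r + 1, v => Within st a r v ∨ ∃ u, Within st a r u ∧ st u v

/-- One round of marking all neighbours of marked vertices. -/
def round : Program :=
  .forLoop 21 2 <| .forLoop 22 2 <| .when (.cell 15 (.var 21)) <|
    .when (.entry 1 (.var 21) (.var 22)) <| .ite (.cell 14 (.var 22)) .nop <|
      .assign 15 (.var 22) (.num 1)

/-- Marks are updated in place, so one round can advance by more than one step. Hence the result is
only enclosed: it contains all direct successors of marked vertices, and it stays within every
property P that is closed under steps. -/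
theorem ends_round {s : Memory} {n L : ℕ} (hn : s 2 0 = n) (hL : n ≤ L) {A : ℕ → ℕ → Prop}
    (hA : ∀ u < n, ∀ v < n, s 1 (s 4 u + v) ≠ 0 ↔ A u v) {P : ℕ → Prop}
    (hP : ∀ v < n, s 15 v ≠ 0 → P v) (hst : ∀ u v, P u → Step n A (s 14) u v → P v) :
    Ends round s (L * (L * 6 + 4) + 2) fun s' =>
      (∀ v < n, s 15 v ≠ 0 → s' 15 v ≠ 0) ∧
      (∀ u v, s 15 u ≠ 0 → Step n A (s 14) u v → s' 15 v ≠ 0) ∧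
      (∀ v < n, s' 15 v ≠ 0 → P v) := by
  let inv (X : ℕ → ℕ → Prop) (s' : Memory) : Prop :=
    (∀ v < n, s 15 v ≠ 0 → s' 15 v ≠ 0) ∧
      (∀ u v, X u v → s 15 u ≠ 0 → Step n A (s 14) u v → s' 15 v ≠ 0) ∧
      (∀ v < n, s' 15 v ≠ 0 → P v)
  refine (Ends.forLoop (T := L * 6 + 2) (n := n) hn hL (by decide) (by decide) (by decide)
    (fun i => inv fun u _ => u < i) ?_ ?_).imp fun s' _ h => ⟨h.1, fun u v hu huv =>
      h.2.1 u v huv.1 hu huv, h.2.2⟩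
  · refine ⟨?_, ?_, ?_⟩
    · simp [Memory.write_apply_of_ne]
    · simp
    · simpa [Memory.write_apply_of_ne] using hP
  intro i hi s₁ hs₁ hf₁ hinv₁
  refine (Ends.forLoop (T := 4) (n := n) ?_ hL (by decide) (by decide) (by decide)
    (fun j => inv fun u v => u < i ∨ u = i ∧ v < j) ?_ ?_).imp ?_
  · rw [hf₁ 2 (by decide), hn]
  · refine ⟨?_, ?_, ?_⟩
    · simpa [Memory.write_apply_of_ne] using hinv₁.1
    · simpa [Memory.write_apply_of_ne] using hinv₁.2.1
    · simpa [Memory.write_apply_of_ne] using hinv₁.2.2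
  swap
  · rintro s' _ ⟨h1, h2, h3⟩
    refine ⟨?_, ?_, ?_⟩
    · simpa [Memory.write_apply_of_ne] using h1
    · intro u v hu
      rw [Memory.write_apply_of_ne _ (by decide)]
      intro h4 h5
      exact h2 u v (by have := h5.2.1; omega) h4 h5
    · simpa [Memory.write_apply_of_ne] using h3
  rintro j hj s₂ hs₂ hf₂ ⟨h1, h2, h3⟩
  have f1 : s₂ 1 = s 1 := by rw [hf₂ 1 (by decide), hf₁ 1 (by decide)]
  have f4 : s₂ 4 = s 4 := by rw [hf₂ 4 (by decide), hf₁ 4 (by decide)]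
  have f14 : s₂ 14 = s 14 := by rw [hf₂ 14 (by decide), hf₁ 14 (by decide)]
  have f21 : s₂ 21 0 = i := by rw [hf₂ 21 (by decide), hs₁]
  have skip : (s₂ 15 i ≠ 0 → ¬ Step n A (s 14) i j) →
      inv (fun u v => u < i ∨ u = i ∧ v < j + 1) (s₂.write 22 0 (j + 1)) := by
    intro hij
    simp only [inv, Memory.write_apply_of_ne, ne_eq, Nat.reduceEqDiff, not_false_eq_true]
    refine ⟨h1, fun u v huv hu hs => ?_, h3⟩
    by_cases huv' : u = i ∧ v = j
    · obtain ⟨rfl, rfl⟩ := huv'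
      exact absurd hs (hij (h1 _ hi hu))
    · exact h2 u v (by omega) hu hs
  refine Ends.when (by decide) (fun h => Ends.when (by decide) (fun h' => Ends.ite (T := 1)
    (fun h'' => Ends.nop (skip ?_)) fun h'' => Ends.assign ?_) fun h' => skip ?_) fun h => skip ?_
  · simp only [Expr.eval_cell, Expr.eval_var, hs₂, f14] at h''
    exact fun _ h => h'' h.2.2.2
  · simp only [Expr.eval_cell, Expr.eval_entry, Expr.eval_var, hs₂, f14, f1, f4, f21] at h h' h''
    have hs : Step n A (s 14) i j := ⟨hi, hj, (hA i hi j hj).1 h', h''⟩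
    simp only [inv, Memory.write_apply_of_ne, ne_eq, Nat.reduceEqDiff, not_false_eq_true,
      Memory.write_apply_self, Expr.eval_var, hs₂, Expr.eval_num, Function.update_apply]
    refine ⟨fun v hv hv' => ?_, fun u v huv hu hs => ?_, fun v hv hv' => ?_⟩
    · split_ifs
      · simp
      · exact h1 v hv hv'
    · split_ifs with hvj
      · simp
      · exact h2 u v (by omega) hu hs
    · by_cases hvj : v = j
      · exact hvj ▸ hst i j (h3 i hi h) hs
      · rw [if_neg hvj] at hv'
        exact h3 v hv hv'
  · simp only [Expr.eval_entry, Expr.eval_var, hs₂, f1, f4, f21] at h'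
    exact fun _ h => (hA i hi j hj).2 h.2.2.1 h'
  · simp only [Expr.eval_cell, Expr.eval_var, f21] at h
    exact fun h' => absurd h h'

/-- Mark the vertices that are reachable from the one in bank `24`, in bank `15`. -/
def propagate : Program :=
  .seq (.forLoop 21 2 (.assign 15 (.var 21) (.num 0))) <|
  .seq (.ite (.cell 14 (.var 24)) .nop (.assign 15 (.var 24) (.num 1))) <|
  .forLoop 25 2 round

/-- After r rounds the marks lie between the vertices within r steps and all reachable vertices. By
`hdiam` the two bounds agree after n rounds. -/
theorem ends_propagate {s : Memory} {n L a : ℕ} (hn : s 2 0 = n) (hL : n ≤ L) {A : ℕ → ℕ → Prop}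
    (hA : ∀ u < n, ∀ v < n, s 1 (s 4 u + v) ≠ 0 ↔ A u v) (ha : s 24 0 = a) (han : a < n)
    (hdiam : s 14 a = 0 → ∀ v, Relation.ReflTransGen (Step n A (s 14)) a v →
      Within (Step n A (s 14)) a n v) :
    Ends propagate s (L * 3 + 2 + (2 + (L * (L * (L * 6 + 4) + 4) + 2))) fun s' =>
      ∀ v < n, s' 15 v ≠ 0 ↔ s 14 a = 0 ∧ Relation.ReflTransGen (Step n A (s 14)) a v := by
  refine Ends.seq (Q := fun s' => ∀ v < n, s' 15 v = 0) (Ends.forLoop (T := 1) (n := n) hn hL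
    (by decide) (by decide) (by decide) (fun i s' => ∀ v < i, s' 15 v = 0) (by simp) ?_) ?_
  · intro i hi s₁ hs₁ hf₁ h
    refine Ends.assign fun v hv => ?_
    simp only [Memory.write_apply_of_ne, ne_eq, Nat.reduceEqDiff, not_false_eq_true,
      Memory.write_apply_self, Expr.eval_var, hs₁, Expr.eval_num, Function.update_apply]
    split_ifs
    · rfl
    · exact h v (by omega)
  intro s₁ hf₁ h₁
  have g14 : s₁ 14 = s 14 := hf₁ 14 (by decide)
  have g24 : s₁ 24 0 = a := by rw [hf₁ 24 (by decide), ha]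
  refine Ends.seq (T := 2) (Q := fun s' => ∀ v < n, s' 15 v ≠ 0 ↔ s 14 a = 0 ∧ v = a)
    (Ends.ite (T := 1) (fun h => Ends.nop ?_) fun h => Ends.assign ?_) ?_
  · simp only [Expr.eval_cell, Expr.eval_var, g14, g24] at h
    simp +contextual [h, h₁]
  · simp only [Expr.eval_cell, Expr.eval_var, g14, g24] at h
    intro v hv
    simp [h, Function.update_apply, g24, h₁ v hv]
  intro s₂ hf₂ h₂
  have f : ∀ a ∉ [15, 21], s₂ a = s a := fun a ha => by
    have : a ≠ 15 ∧ a ≠ 21 := by simpa using ha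
    rw [hf₂ a (by simp [Program.writes, this]), hf₁ a (by
      simp [Program.forLoop, Program.set, Program.writes, this])]
  refine (Ends.forLoop (T := L * (L * 6 + 4) + 2) (n := n) ?_ hL (by decide) (by decide) (by decide)
    (fun r s' => (∀ v < n, s' 15 v ≠ 0 →
        s 14 a = 0 ∧ Relation.ReflTransGen (Step n A (s 14)) a v) ∧
      (s 14 a = 0 → ∀ v < n, Within (Step n A (s 14)) a r v → s' 15 v ≠ 0)) ?_ ?_).imp ?_
  · rw [f 2 (by decide), hn]
  · simp only [Memory.write_apply_of_ne, ne_eq, Nat.reduceEqDiff, not_false_eq_true]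
    refine ⟨fun v hv h => ?_, fun h0 v hv h => (h₂ v hv).2 ⟨h0, h⟩⟩
    obtain ⟨h0, rfl⟩ := (h₂ v hv).1 h
    exact ⟨h0, .refl⟩
  · rintro r hr s₃ hs₃ hf₃ ⟨h3, h4⟩
    have g : ∀ a ∉ [15, 21, 22, 25], s₃ a = s a := fun a ha => by
      have : a ≠ 15 ∧ a ≠ 21 ∧ a ≠ 22 ∧ a ≠ 25 := by simpa using ha
      rw [hf₃ a (by simp [round, Program.forLoop, Program.when, Program.set, Program.writes, this]),
        f a (by simp [this])]
    have k14 := g 14 (by decide)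
    refine (ends_round (n := n) (A := A) (P := fun v => s 14 a = 0 ∧
      Relation.ReflTransGen (Step n A (s 14)) a v) ?_ hL ?_ h3 ?_).imp ?_
    · rw [g 2 (by decide), hn]
    · rw [g 1 (by decide), g 4 (by decide)]
      exact hA
    · rw [k14]
      exact fun u v hu huv => ⟨hu.1, hu.2.tail huv⟩
    · rintro s' - ⟨h5, h6, h7⟩
      simp only [Memory.write_apply_of_ne, ne_eq, Nat.reduceEqDiff, not_false_eq_true]
      refine ⟨h7, fun h0 v hv hw => ?_⟩
      rcases hw with hw | ⟨u, hu, huv⟩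
      · exact h5 v hv (h4 h0 v hv hw)
      · exact h6 u v (h4 h0 u huv.1 hu) (k14 ▸ huv)
  · rintro s' - ⟨h3, h4⟩ v hv
    exact ⟨h3 v hv, fun h => h4 h.1 v hv (hdiam h.1 v h.2)⟩

open Classical in
/-- The deletion of the places where `x` is nonzero is a solution for the budget `K`. -/
def Solves (n : ℕ) (A : ℕ → ℕ → Prop) (W : ℕ → ℕ) (K : ℕ) (x : ℕ → ℕ) : Prop :=
  ∀ a < n, (∑ v ∈ Finset.range n, if x v ≠ 0 then W v else 0) +
    (∑ v ∈ Finset.range n,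
      if x a = 0 ∧ Relation.ReflTransGen (Step n A x) a v then W v else 0) ≤ K

/-- Set bank `18` to `0` if bank `7` holds `0` and the set in bank `14`, of weight given in bank
`16`, is a solution for the budget in bank `8`, and to another number if not. -/
def verify : Program :=
  .seq (.set 18 (.var 7)) <| .forLoop 24 2 <| .seq propagate <| .seq (sumOver 17 15) <|
    .when (.sub (.add (.var 16) (.var 17)) (.var 8)) (.set 18 (.num 1))

theorem ends_verify {s : Memory} {n L : ℕ} (hn : s 2 0 = n) (hL : n ≤ L) {A : ℕ → ℕ → Prop}
    (hA : ∀ u < n, ∀ v < n, s 1 (s 4 u + v) ≠ 0 ↔ A u v)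
    (hdiam : ∀ a < n, s 14 a = 0 → ∀ v, Relation.ReflTransGen (Step n A (s 14)) a v →
      Within (Step n A (s 14)) a n v)
    (hsum : s 16 0 = ∑ v ∈ Finset.range n, if s 14 v ≠ 0 then s 5 v else 0) :
    Ends verify s (1 + (L * ((L * 3 + 2 + (2 + (L * (L * (L * 6 + 4) + 4) + 2))) +
      ((1 + (L * 4 + 2)) + 2) + 2) + 2)) fun s' =>
        s' 18 0 = 0 ↔ s 7 0 = 0 ∧ Solves n A (s 5) (s 8 0) (s 14) := by
  classical
  refine Ends.set_seq ?_
  refine Ends.forLoop (n := n) (by simp [Memory.write_apply_of_ne, hn]) hL (by decide)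
    (by decide) (by decide)
    (fun i s' => s' 18 0 = 0 ↔ s 7 0 = 0 ∧ ∀ a < i,
      (∑ v ∈ Finset.range n, if s 14 v ≠ 0 then s 5 v else 0) +
      (∑ v ∈ Finset.range n,
        if s 14 a = 0 ∧ Relation.ReflTransGen (Step n A (s 14)) a v then s 5 v else 0) ≤ s 8 0)
    ?_ ?_
  · simp [Memory.write_apply_of_ne]
  intro i hi s₁ hs₁ hf₁ hinv
  have f : ∀ a ∉ [18, 24, 15, 21, 22, 25, 17], s₁ a = s a := fun a ha => by
    have : a ≠ 18 ∧ a ≠ 24 ∧ a ≠ 15 ∧ a ≠ 21 ∧ a ≠ 22 ∧ a ≠ 25 ∧ a ≠ 17 := by simpa using ha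
    rw [hf₁ a (by simp [propagate, sumOver, round, Program.forLoop, Program.when, Program.set,
      Program.writes, this]), Memory.write_apply_of_ne _ this.1]
  have f2 := f 2 (by decide)
  have f14 := f 14 (by decide)
  refine Ends.seq (ends_propagate (n := n) (A := A) (by rw [f2, hn]) hL
    (by rw [f 1 (by decide), f 4 (by decide)]; exact hA) hs₁ hi
    (by rw [f14]; exact hdiam i hi)) fun s₂ hf₂ h₂ => ?_
  rw [f14] at h₂
  refine Ends.seq (ends_sumOver (n := n) (by decide) (by decide) (by decide) (by decide) (by decide)
    (by rw [hf₂ 2 (by decide), f2, hn]) hL) fun s₃ hf₃ h₃ => ?_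
  rw [hf₂ 5 (by decide), f 5 (by decide)] at h₃
  have g16 : s₃ 16 0 = s 16 0 := by rw [hf₃ 16 (by decide), hf₂ 16 (by decide), f 16 (by decide)]
  have g8 : s₃ 8 0 = s 8 0 := by rw [hf₃ 8 (by decide), hf₂ 8 (by decide), f 8 (by decide)]
  have g18 : s₃ 18 0 = s₁ 18 0 := by rw [hf₃ 18 (by decide), hf₂ 18 (by decide)]
  have h17 : s₃ 17 0 = ∑ v ∈ Finset.range n,
      if s 14 i = 0 ∧ Relation.ReflTransGen (Step n A (s 14)) i v then s 5 v else 0 := by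
    rw [h₃]
    refine Finset.sum_congr rfl fun v hv => ?_
    simp only [h₂ v (Finset.mem_range.1 hv)]
  rw [hsum] at g16
  refine Ends.when le_rfl (fun h => Ends.set ?_) fun h => ?_
  · simp only [Expr.eval_sub, Expr.eval_add, Expr.eval_var, g8, g16, h17] at h
    simp only [Memory.write_apply_of_ne, ne_eq, Nat.reduceEqDiff, not_false_eq_true,
      Memory.write_apply_self, Expr.eval_num, Function.update_self, one_ne_zero, false_iff, not_and,
      not_forall]
    exact fun _ => ⟨i, Nat.lt_succ_self i, fun h' => h (Nat.sub_eq_zero_of_le h')⟩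
  · simp only [Expr.eval_sub, Expr.eval_add, Expr.eval_var, g8, g16, h17, tsub_eq_zero_iff_le] at h
    rw [Memory.write_apply_of_ne _ (by decide), g18, hinv]
    refine and_congr_right fun _ => ⟨fun h' a ha => ?_, fun h' a ha => h' a (by omega)⟩
    rcases Nat.lt_succ_iff_lt_or_eq.1 ha with ha | rfl
    exacts [h' a ha, h]

/-- Look for a solution among the sets that are encoded by the numbers below the one in bank
`13`. -/
def search : Program :=
  .seq (.set 0 (.num 0)) <| .forLoop 20 13 <| .seq decode <| .seq (sumOver 16 14) <|
    .seq verify <| .ite (.var 18) .nop (.set 0 (.num 1))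

/-- A bound on the number of steps of one iteration of `search`. -/
def searchTime (L : ℕ) : ℕ :=
  (1 + (L * 5 + 2)) + ((1 + (L * 4 + 2)) + ((1 + (L * ((L * 3 + 2 +
    (2 + (L * (L * (L * 6 + 4) + 4) + 2))) + ((1 + (L * 4 + 2)) + 2) + 2) + 2)) + 2))

/-- Needed when a candidate is rejected: the machine tests one indicator function for m, and this
must rule out every indicator function that m encodes. The values from n on are not determined, but
`Solves.congr` shows that they do not matter. -/
theorem decodes_unique {r : ℕ → ℕ} {m n : ℕ} {x y : ℕ → ℕ} (hr : ∀ v < n, r v ≤ v)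
    (hx : Decodes r m n x) (hy : Decodes r m n y) : ∀ v < n, x v = y v := by
  intro v
  induction v using Nat.strong_induction_on with
  | _ v ih =>
    intro hv
    rw [hx v hv, hy v hv]
    split_ifs with h
    · rfl
    · have := hr v hv
      exact ih _ (by omega) (by omega)

theorem Solves.congr {n : ℕ} {A : ℕ → ℕ → Prop} {W x y : ℕ → ℕ} {K : ℕ} (h : ∀ v < n, x v = y v)
    (hx : Solves n A W K x) : Solves n A W K y := by
  have hst : Step n A y = Step n A x := by
    funext u v
    refine propext (and_congr_right fun _ => and_congr_right fun hv => ?_)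
    rw [h v hv]
  intro a ha
  have h1 : ∑ v ∈ Finset.range n, (if y v ≠ 0 then W v else 0) =
      ∑ v ∈ Finset.range n, if x v ≠ 0 then W v else 0 :=
    Finset.sum_congr rfl fun v hv => by rw [h v (Finset.mem_range.1 hv)]
  rw [h1, hst, ← h a ha]
  exact hx a ha

theorem ends_search {s : Memory} {n L : ℕ} (hn : s 2 0 = n) (hL : n ≤ L) {A : ℕ → ℕ → Prop}
    (hA : ∀ u < n, ∀ v < n, s 1 (s 4 u + v) ≠ 0 ↔ A u v)
    (hdiam : ∀ x : ℕ → ℕ, ∀ a < n, x a = 0 → ∀ v, Relation.ReflTransGen (Step n A x) a v →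
      Within (Step n A x) a n v)
    (hr : ∀ v < n, s 12 v ≤ v) :
    Ends search s (1 + (s 13 0 * (searchTime L + 2) + 2)) fun s' =>
      s' 0 0 ≠ 0 ↔ s 7 0 = 0 ∧
        ∃ m < s 13 0, ∃ x, Decodes (s 12) m n x ∧ Solves n A (s 5) (s 8 0) x := by
  refine Ends.set_seq ?_
  refine (Ends.forLoop (T := searchTime L) (n := s 13 0) (by simp [Memory.write_apply_of_ne]) le_rfl
    (by decide) (by decide) (by decide) (fun i s' => s' 0 0 ≠ 0 ↔ s 7 0 = 0 ∧
      ∃ m < i, ∃ x, Decodes (s 12) m n x ∧ Solves n A (s 5) (s 8 0) x) ?_ ?_)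
  · simp [Memory.write_apply_of_ne]
  intro i hi s₁ hs₁ hf₁ hinv
  have f : ∀ a ∉ [0, 14, 15, 16, 17, 18, 19, 20, 21, 22, 24, 25], s₁ a = s a := fun a ha => by
    simp only [List.mem_cons, List.not_mem_nil, or_false, not_or] at ha
    rw [hf₁ a (by simp [decode, verify, propagate, sumOver, round, Program.forLoop, Program.when,
      Program.set, Program.writes, ha]), Memory.write_apply_of_ne _ ha.1]
  refine Ends.seq (ends_decode (n := n) (by rw [f 2 (by decide), hn]) hL
    (by rw [f 12 (by decide)]; exact hr)) fun s₂ hf₂ h₂ => ?_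
  rw [f 12 (by decide), hs₁] at h₂
  refine Ends.seq (ends_sumOver (n := n) (by decide) (by decide) (by decide) (by decide) (by decide)
    (by rw [hf₂ 2 (by decide), f 2 (by decide), hn]) hL) fun s₃ hf₃ h₃ => ?_
  have g : ∀ a ∉ [0, 14, 15, 16, 17, 18, 19, 20, 21, 22, 24, 25], s₃ a = s a := fun a ha => by
    have ha' := ha
    simp only [List.mem_cons, List.not_mem_nil, or_false, not_or] at ha
    rw [hf₃ a (by simp [sumOver, Program.forLoop, Program.when, Program.set, Program.writes, ha]),
      hf₂ a (by simp [decode, Program.forLoop, Program.set, Program.writes, ha]), f a ha']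
  have g14 : s₃ 14 = s₂ 14 := hf₃ 14 (by decide)
  refine Ends.seq (ends_verify (n := n) (A := A) (by rw [g 2 (by decide), hn]) hL
    (by rw [g 1 (by decide), g 4 (by decide)]; exact hA) (hdiam _) ?_) fun s₄ hf₄ h₄ => ?_
  · rw [h₃, g14, hf₃ 5 (by decide)]
  rw [g 7 (by decide), g 5 (by decide), g 8 (by decide), g14] at h₄
  have k0 : s₄ 0 0 = s₁ 0 0 := by
    rw [hf₄ 0 (by decide), hf₃ 0 (by decide), hf₂ 0 (by decide)]
  refine Ends.ite (T := 1) (fun h => Ends.nop ?_) fun h => Ends.set ?_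
  · rw [Expr.eval_var, ne_eq, h₄] at h
    rw [Memory.write_apply_of_ne _ (by decide), k0, hinv]
    refine and_congr_right fun h7 => ⟨fun ⟨m, hm, hx⟩ => ⟨m, by omega, hx⟩, ?_⟩
    rintro ⟨m, hm, x, hx, hx'⟩
    rcases Nat.lt_succ_iff_lt_or_eq.1 hm with hm | rfl
    · exact ⟨m, hm, x, hx, hx'⟩
    · exact absurd ⟨h7, hx'.congr (decodes_unique hr hx h₂)⟩ h
  · rw [Expr.eval_var, h₄] at h
    simp only [Memory.write_apply_of_ne, ne_eq, not_false_eq_true,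
      Memory.write_apply_self, Expr.eval_num, Function.update_self, one_ne_zero, true_iff,
      OfNat.zero_ne_ofNat]
    exact ⟨h.1, i, Nat.lt_succ_self i, _, h₂, h.2⟩

end RAM

/-! ### Reading the input word -/

namespace RAM

theorem drop_succ_of_drop_eq_cons {α : Type*} {x l : List α} {p : ℕ} {a : α}
    (h : x.drop p = a :: l) : x.drop (p + 1) = l := by
  rw [← List.drop_drop, h, List.drop_one, List.tail_cons]

/-- Bank `1` holds the word `x`. -/
def Memory.Holds (s : Memory) (x : List Bool) : Prop := ∀ i, s 1 i = (x.getD i false).toNat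

theorem Memory.Holds.apply {s : Memory} {x l : List Bool} {p : ℕ} {b : Bool} (hx : s.Holds x)
    (h : x.drop p = b :: l) : s 1 p = b.toNat := by
  have := congrArg (fun y => y.getD 0 false) h
  rw [hx p]
  congr 1
  simpa [List.getD_eq_getElem?_getD] using this

/-- Read a number in unary and put it into bank `2`. -/
def readUnary : Program := .loop (.cell 1 (.var 2)) (.set 2 (.add (.var 2) (.num 1)))

/-- Bank `2` is both the position and the count. This is correct because the unary number stands at
the beginning of the input; a general start p is needed for the induction. -/
theorem ends_readUnary {x r : List Bool} (m : ℕ) : ∀ {s : Memory} {p : ℕ}, s.Holds x → s 2 0 = p →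
    x.drop p = List.replicate m true ++ false :: r →
    Ends readUnary s (m * 2 + 1) fun s' => s' 2 0 = p + m := by
  induction m with
  | zero =>
    intro s p hx hp h
    refine (Ends.loop_false ?_ hp).of_le (by omega)
    simp [hp, hx.apply h]
  | succ m ih =>
    intro s p hx hp h
    rw [List.replicate_succ, List.cons_append] at h
    refine (Ends.loop_true (T := 1) (T' := m * 2 + 1) ?_ (Ends.set ?_)).of_le (by omega)
    · simp [hp, hx.apply h]
    · refine (ih (p := p + 1) ?_ ?_ (drop_succ_of_drop_eq_cons h)).imp fun s' _ h' => ?_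
      · intro i; rw [Memory.write_apply_of_ne _ (by decide), hx i]
      · simp [hp]
      · rw [h']; omega

/-- The number with given binary digits. -/
def bitsValue : List Bool → ℕ
  | [] => 0
  | b :: l => b.toNat + 2 * bitsValue l

theorem bitsValue_bits (m : ℕ) : bitsValue m.bits = m := by
  induction m using Nat.binaryRec' with
  | zero => simp [bitsValue]
  | bit b m h ih =>
    rw [Nat.bits_append_bit _ _ h, bitsValue, ih, Nat.bit_val]
    omega

/-- Read the digits of a number in binary. -/
def readDigits : Program :=
  .loop (.cell 1 (.var 3)) <| .seq (.when (.cell 1 (.add (.var 3) (.num 1)))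
    (.set 8 (.add (.var 8) (.var 9)))) <|
    .seq (.set 9 (.add (.var 9) (.var 9))) (.set 3 (.add (.var 3) (.num 2)))

/-- Bank `8` accumulates the value and bank `9` holds the current power of two; general c and d make
the induction on the digits work. -/
theorem ends_readDigits {x r : List Bool} (l : List Bool) : ∀ {s : Memory} {p c d : ℕ}, s.Holds x →
    s 3 0 = p → s 8 0 = c → s 9 0 = d →
    x.drop p = l.flatMap (fun b => [true, b]) ++ false :: r →
    Ends readDigits s (l.length * 5 + 1) fun s' =>
      s' 8 0 = c + d * bitsValue l ∧ x.drop (s' 3 0) = false :: r := by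
  induction l with
  | nil =>
    intro s p c d hx hp hc hd h
    refine (Ends.loop_false ?_ ?_).of_le (by omega)
    · simp [hp, hx.apply h]
    · simpa [bitsValue, hc, hp] using h
  | cons b l ih =>
    intro s p c d hx hp hc hd h
    simp only [List.flatMap_cons, List.cons_append, List.nil_append] at h
    have h' := drop_succ_of_drop_eq_cons h
    have h'' := drop_succ_of_drop_eq_cons h'
    refine (Ends.loop_true (T := 2 + (1 + 1)) (T' := l.length * 5 + 1) ?_
      (Ends.seq (Q := fun s' => s'.Holds x ∧ s' 3 0 = p ∧ s' 8 0 = c + d * b.toNat ∧ s' 9 0 = d)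
      (Ends.when le_rfl (fun hb => Ends.set ?_) fun hb => ?_) ?_)).of_le (by
        simp only [List.length_cons]; omega)
    · simp [hp, hx.apply h]
    · simp [hp, hx.apply h'] at hb
      refine ⟨fun i => ?_, ?_, ?_, ?_⟩
      · rw [Memory.write_apply_of_ne _ (by decide), hx i]
      · simp [Memory.write_apply_of_ne, hp]
      · simp [hc, hd, hb]
      · simp [Memory.write_apply_of_ne, hd]
    · simp [hp, hx.apply h'] at hb
      exact ⟨hx, hp, by simp [hc, hb], hd⟩
    · rintro s' - ⟨k1, k2, k3, k4⟩
      refine Ends.set_seq (Ends.set ?_)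
      refine (ih (p := p + 2) (c := c + d * b.toNat) (d := d + d) ?_ ?_ ?_ ?_ h'').imp ?_
      · intro i
        rw [Memory.write_apply_of_ne _ (by decide), Memory.write_apply_of_ne _ (by decide), k1 i]
      · simp [Memory.write_apply_of_ne, k2]
      · simp [Memory.write_apply_of_ne, k3]
      · simp [Memory.write_apply_of_ne, k4]
      · rintro s'' - ⟨h8, h3⟩
        refine ⟨?_, h3⟩
        rw [h8, bitsValue]
        ring

/-- Read a number in self-delimiting binary code, put it into bank `8` and move the position in bank
`3` to the end of its code. -/
def readNat : Program :=
  .seq (.set 8 (.num 0)) <| .seq (.set 9 (.num 1)) <| .seq readDigits <|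
    .set 3 (.add (.var 3) (.num 1))

open VertexIntegrity in
theorem ends_readNat {x r : List Bool} {m L : ℕ} {s : Memory} (hx : s.Holds x)
    (hL : x.length ≤ L) (h : x.drop (s 3 0) = encodeNat m ++ r) :
    Ends readNat s (1 + (1 + ((L * 5 + 1) + 1))) fun s' =>
      s' 8 0 = m ∧ x.drop (s' 3 0) = r := by
  rw [encodeNat, List.append_assoc] at h
  have hl : m.bits.length ≤ L := by
    have h1 := congrArg List.length h
    simp only [List.length_drop, List.length_append, List.length_flatMap] at h1
    simp at h1
    omega
  refine Ends.set_seq (Ends.set_seq (Ends.seq ((ends_readDigits (x := x) (r := r) m.bits (p := s 3 0)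
    (c := 0) (d := 1) ?_ ?_ ?_ ?_ h).of_le (by omega)) ?_))
  · intro i
    rw [Memory.write_apply_of_ne _ (by decide), Memory.write_apply_of_ne _ (by decide), hx i]
  · simp [Memory.write_apply_of_ne]
  · simp [Memory.write_apply_of_ne]
  · simp [Memory.write_apply_of_ne]
  · rintro s' - ⟨h8, h3⟩
    rw [zero_add, one_mul, bitsValue_bits] at h8
    refine Ends.set ⟨?_, ?_⟩
    · simp [Memory.write_apply_of_ne, h8]
    · simpa using drop_succ_of_drop_eq_cons h3

/-- Read the input. The number of vertices is put into bank `2`, the positions of the rows of the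
adjacency matrix into bank `4`, the weights into bank `5`, and the sign and the absolute value of
the budget into the banks `7` and `8`. -/
def readInput : Program :=
  .seq readUnary <| .seq (.set 3 (.add (.var 2) (.num 1))) <|
  .seq (.forLoop 21 2 (.seq (.assign 4 (.var 21) (.var 3)) (.set 3 (.add (.var 3) (.var 2))))) <|
  .seq (.forLoop 21 2 (.seq readNat (.assign 5 (.var 21) (.var 8)))) <|
  .seq (.set 7 (.cell 1 (.var 3))) <| .seq (.set 3 (.add (.var 3) (.num 1))) readNat

/-- A bound on the number of steps of `readInput`. -/
def readInputTime (L : ℕ) : ℕ :=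
  (L * 2 + 1) + (1 + ((L * ((1 + 1) + 2) + 2) +
    ((L * ((1 + (1 + ((L * 5 + 1) + 1))) + 1 + 2) + 2) +
      (1 + (1 + (1 + (1 + ((L * 5 + 1) + 1))))))))

open VertexIntegrity in
-- The matrix is not copied. It stays in bank `1`, after the n + 1 symbols of the unary header, and
-- bank `4` records that row i starts at n + 1 + i * n.
theorem ends_readInput {n k L : ℕ} {g : List Bool} {l : List ℕ} {b : Bool} (hg : g.length = n * n)
    (hl : l.length = n) {x : List Bool}
    (hx : x = List.replicate n true ++ false :: (g ++ (l.flatMap encodeNat ++ b :: encodeNat k)))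
    (hL : x.length ≤ L) :
    Ends readInput (Memory.init x) (readInputTime L) fun s' =>
      s' 2 0 = n ∧ (∀ i < n, s' 4 i = n + 1 + i * n) ∧ (∀ i < n, s' 5 i = l.getD i 0) ∧
      s' 7 0 = b.toNat ∧ s' 8 0 = k := by
  have hnL : n ≤ L := by
    have := congrArg List.length hx
    simp at this
    omega
  have hdrop : x.drop (n + 1 + n * n) = l.flatMap encodeNat ++ b :: encodeNat k := by
    have h1 : n + 1 + n * n = (List.replicate n true ++ false :: g).length := by simp [hg]; omega
    have h2 : x = (List.replicate n true ++ false :: g) ++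
      (l.flatMap encodeNat ++ b :: encodeNat k) := by simp [hx]
    rw [h2, h1, List.drop_left]
  have hx1 : ∀ s : Memory, s 1 = Memory.init x 1 → s.Holds x := by
    intro s hs i
    rw [hs]
    simp [Memory.init]
  refine Ends.seq ((ends_readUnary (x := x) n (p := 0) (hx1 _ rfl) (by simp [Memory.init])
    (by rw [List.drop_zero, hx])).of_le (by omega)) fun s₁ hf₁ h₁ => Ends.set_seq ?_
  rw [zero_add] at h₁
  refine Ends.seq (Ends.forLoop (T := 1 + 1) (n := n) (by simp [Memory.write_apply_of_ne, h₁]) hnL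
    (by decide) (by decide) (by decide)
    (fun i s' => s' 3 0 = n + 1 + i * n ∧ ∀ j < i, s' 4 j = n + 1 + j * n) ?_ ?_) ?_
  · simp [Memory.write_apply_of_ne, h₁]
  · rintro i hi s hs hf ⟨h3, h4⟩
    have f2 : s 2 0 = n := by
      rw [hf 2 (by decide), Memory.write_apply_of_ne _ (by decide), h₁]
    refine Ends.assign_seq (Ends.set ⟨?_, ?_⟩)
    · simp [Memory.write_apply_of_ne, h3, f2]
      ring
    · intro j hj
      simp only [Memory.write_apply_of_ne, ne_eq, Nat.reduceEqDiff, not_false_eq_true,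
        Memory.write_apply_self, Expr.eval_var, hs, h3, Function.update_apply]
      split_ifs with hji
      · rw [hji]
      · exact h4 j (by omega)
  rintro s₂ hf₂ ⟨h3, h4⟩
  have g2 : s₂ 2 0 = n := by
    rw [hf₂ 2 (by decide), Memory.write_apply_of_ne _ (by decide), h₁]
  have g1 : s₂ 1 = Memory.init x 1 := by
    rw [hf₂ 1 (by decide), Memory.write_apply_of_ne _ (by decide), hf₁ 1 (by decide)]
  refine Ends.seq (Ends.forLoop (T := (1 + (1 + ((L * 5 + 1) + 1))) + 1) (n := n) g2 hnL
    (by decide) (by decide) (by decide)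
    (fun i s' => x.drop (s' 3 0) = (l.drop i).flatMap encodeNat ++ b :: encodeNat k ∧
      ∀ j < i, s' 5 j = l.getD j 0) ?_ ?_) ?_
  · simp [Memory.write_apply_of_ne, h3, hdrop]
  · rintro i hi s hs hf ⟨h3, h5⟩
    have hi' : i < l.length := by omega
    rw [List.drop_eq_getElem_cons hi', List.flatMap_cons, List.append_assoc] at h3
    refine Ends.seq (ends_readNat (hx1 _ (by rw [hf 1 (by decide), g1])) hL h3) ?_
    rintro s' hf' ⟨k8, k3⟩
    have k21 : s' 21 0 = i := by rw [hf' 21 (by decide), hs]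
    refine Ends.assign ⟨?_, ?_⟩
    · simpa [Memory.write_apply_of_ne] using k3
    · intro j hj
      simp only [Memory.write_apply_of_ne, ne_eq, Nat.reduceEqDiff, not_false_eq_true,
        Memory.write_apply_self, Expr.eval_var, k21, k8, Function.update_apply]
      split_ifs with hji
      · rw [hji, List.getD_eq_getElem _ _ hi']
      · rw [hf' 5 (by decide)]
        exact h5 j (by omega)
  rintro s₃ hf₃ ⟨k3, k5⟩
  rw [List.drop_of_length_le hl.le, List.flatMap_nil, List.nil_append] at k3
  have g1' : s₃ 1 = Memory.init x 1 := by rw [hf₃ 1 (by decide), g1]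
  refine Ends.set_seq (Ends.set_seq ?_)
  refine (ends_readNat (r := []) (m := k) (hx1 _ ?_) hL ?_).imp ?_
  · simp [Memory.write_apply_of_ne, g1']
  · simp [Memory.write_apply_of_ne, drop_succ_of_drop_eq_cons k3]
  · rintro s' hf' ⟨m8, m3⟩
    refine ⟨?_, ?_, ?_, ?_, m8⟩
    · rw [hf' 2 (by decide)]
      simp only [Memory.write_apply_of_ne, ne_eq, Nat.reduceEqDiff, not_false_eq_true]
      rw [hf₃ 2 (by decide), g2]
    · rw [hf' 4 (by decide)]
      simp only [Memory.write_apply_of_ne, ne_eq, Nat.reduceEqDiff, not_false_eq_true]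
      rw [hf₃ 4 (by decide)]
      exact h4
    · rw [hf' 5 (by decide)]
      simp only [Memory.write_apply_of_ne, ne_eq, Nat.reduceEqDiff, not_false_eq_true]
      exact k5
    · rw [hf' 7 (by decide)]
      simp [Memory.write_apply_of_ne, (hx1 s₃ g1').apply k3]

end RAM

/-! ### Computing the border classes, and the whole program -/

namespace RAM

/-- Make the adjacency matrix reflexive. -/
def reflexive : Program :=
  .forLoop 21 2 (.assign 1 (.add (.cell 4 (.var 21)) (.var 21)) (.num 1))

theorem ends_reflexive {s : Memory} {n L : ℕ} (hn : s 2 0 = n) (hL : n ≤ L)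
    (hrow : ∀ i < n, ∀ j < n, ∀ i' < n, ∀ j' < n, s 4 i + j = s 4 i' + j' → i = i' ∧ j = j') :
    Ends reflexive s (L * (1 + 2) + 2) fun s' =>
      ∀ i < n, ∀ j < n, s' 1 (s 4 i + j) = if i = j then 1 else s 1 (s 4 i + j) := by
  refine (Ends.forLoop (T := 1) (n := n) hn hL (by decide) (by decide) (by decide)
    (fun a s' => ∀ i < n, ∀ j < n,
      s' 1 (s 4 i + j) = if i = j ∧ i < a then 1 else s 1 (s 4 i + j)) ?_ ?_).imp ?_
  · simp [Memory.write_apply_of_ne]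
  · intro a ha s₁ hs₁ hf₁ h
    have f4 : s₁ 4 = s 4 := hf₁ 4 (by decide)
    refine Ends.assign fun i hi j hj => ?_
    simp only [Memory.write_apply_of_ne, ne_eq, not_false_eq_true,
      Memory.write_apply_self, Expr.eval_var, Expr.eval_add, Expr.eval_cell, Expr.eval_num, hs₁, f4,
      Function.update_apply, OfNat.one_ne_ofNat]
    by_cases hij : i = a ∧ j = a
    · obtain ⟨rfl, rfl⟩ := hij
      simp
    · rw [if_neg fun h' => hij (hrow i hi j hj a ha a ha h'), h i hi j hj]
      refine if_congr ?_ rfl rfl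
      omega
  · intro s' _ h i hi j hj
    rw [h i hi j hj]
    simp [hi]

/-- Compute the tables that are needed for `search`. -/
def tables : Program :=
  .seq reflexive <|
  .seq (table 10 (.dist (.entry 1 (.var 21) (.var 23)) (.entry 1 (.var 22) (.var 23)))
    (.entry 1 (.var 21) (.var 22))) <|
  .seq (table 11 (.dist (.entry 10 (.var 21) (.var 23)) (.entry 10 (.var 22) (.var 23))) (.num 1))
    representatives

/-- A bound on the number of steps of `tables`. -/
def tablesTime (L : ℕ) : ℕ :=
  (L * (1 + 2) + 2) + ((L * (L * (L * 4 + 4) + 4) + 2) + ((L * (L * (L * 4 + 4) + 4) + 2) +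
    (1 + (L * (L * 5 + 6) + 2))))

/-- The elements of row `i` that distinguish `i` from others: the neighbours whose closed
neighbourhood is different. -/
def Borders (n : ℕ) (A : ℕ → ℕ → Prop) (i j : ℕ) : Prop := A i j ∧ ∃ l < n, ¬ (A i l ↔ A j l)

/-- Vertices with the same border. -/
def SameBorder (n : ℕ) (A : ℕ → ℕ → Prop) (i j : ℕ) : Prop :=
  ∀ l < n, Borders n A i l ↔ Borders n A j l

open Classical in
-- With ones on the diagonal, the rows are closed neighbourhoods. Comparing rows i and j and writing
-- the adjacency of i and j where they differ gives the matrix of borders; comparing the rows of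
-- that matrix gives a table whose zeros are the pairs with equal border.
theorem ends_tables {s : Memory} {n L : ℕ} (hn : s 2 0 = n) (hL : n ≤ L)
    (hrow : ∀ i < n, ∀ j < n, ∀ i' < n, ∀ j' < n, s 4 i + j = s 4 i' + j' → i = i' ∧ j = j')
    (h10 : ∀ a, s 10 a = 0) (h11 : ∀ a, s 11 a = 0) (h12 : ∀ a, s 12 a = 0) {A : ℕ → ℕ → Prop}
    (hA : ∀ i < n, ∀ j < n, (if i = j then 1 else s 1 (s 4 i + j)) = if A i j then 1 else 0) :
    Ends tables s (tablesTime L) fun s' =>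
      (∀ i < n, ∀ j < n, s' 1 (s 4 i + j) ≠ 0 ↔ A i j) ∧
      Represents (SameBorder n A) n (s' 12) ∧
      s' 13 0 = 2 ^ Nat.count (fun i => ∀ j < i, ¬ SameBorder n A i j) n := by
  refine Ends.seq (ends_reflexive hn hL hrow) fun s₁ hf₁ h₁ => ?_
  have e₁ : s₁ 4 = s 4 := hf₁ 4 (by decide)
  replace h₁ : ∀ i < n, ∀ j < n, s₁ 1 (s 4 i + j) = if A i j then 1 else 0 := fun i hi j hj => by
    rw [h₁ i hi j hj, hA i hi j hj]
  refine Ends.seq (ends_table (n := n) (C := fun i j l => ¬ (A i l ↔ A j l))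
    (E := fun i j => if A i j then 1 else 0) (by rw [hf₁ 2 (by decide), hn]) hL (by rwa [e₁])
    (by decide) (by decide) (by decide) (by decide) (by decide) (by rwa [hf₁ 10 (by decide)])
    ?_ ?_) fun s₂ hf₂ h₂ => ?_
  · intro s' hs' h21 h22 h23
    rw [ne_eq, Expr.eval_dist_eq_zero]
    simp only [Expr.eval_entry, Expr.eval_var, hs' 1 (by decide) (by decide) (by decide) (by decide),
      hs' 4 (by decide) (by decide) (by decide) (by decide), e₁, h₁ _ h21 _ h23, h₁ _ h22 _ h23]
    split_ifs <;> simp [*]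
  · intro s' hs' h21 h22
    simp only [Expr.eval_entry, Expr.eval_var, hs' 1 (by decide) (by decide) (by decide) (by decide),
      hs' 4 (by decide) (by decide) (by decide) (by decide), e₁, h₁ _ h21 _ h22]
  have e₂ : s₂ 4 = s 4 := by rw [hf₂ 4 (by decide), e₁]
  replace h₂ : ∀ i < n, ∀ j < n, s₂ 10 (s 4 i + j) = if Borders n A i j then 1 else 0 := by
    intro i hi j hj
    have h := h₂ i hi j hj
    rw [e₁] at h
    by_cases hl : ∃ l < n, ¬ (A i l ↔ A j l)
    · rw [h.1 hl]
      simp only [Borders, hl, and_true]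
    · rw [h.2 hl, if_neg fun h' => hl h'.2]
  refine Ends.seq (ends_table (n := n) (C := fun i j l => ¬ (Borders n A i l ↔ Borders n A j l))
    (E := fun _ _ => 1) (by rw [hf₂ 2 (by decide), hf₁ 2 (by decide), hn]) hL (by rwa [e₂])
    (by decide) (by decide) (by decide) (by decide) (by decide)
    (by rwa [hf₂ 11 (by decide), hf₁ 11 (by decide)])
    ?_ fun _ _ _ _ => rfl) fun s₃ hf₃ h₃ => ?_
  · intro s' hs' h21 h22 h23
    rw [ne_eq, Expr.eval_dist_eq_zero]
    simp only [Expr.eval_entry, Expr.eval_var,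
      hs' 10 (by decide) (by decide) (by decide) (by decide),
      hs' 4 (by decide) (by decide) (by decide) (by decide), e₂, h₂ _ h21 _ h23, h₂ _ h22 _ h23]
    split_ifs <;> simp [*]
  have e₃ : s₃ 4 = s 4 := by rw [hf₃ 4 (by decide), e₂]
  rw [e₂] at h₃
  refine (ends_representatives (n := n) (R := SameBorder n A)
    (by rw [hf₃ 2 (by decide), hf₂ 2 (by decide), hf₁ 2 (by decide), hn]) hL ?_
    (by rwa [hf₃ 12 (by decide), hf₂ 12 (by decide), hf₁ 12 (by decide)])).imp ?_
  · intro i hi j hj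
    rw [e₃]
    by_cases hl : ∃ l < n, ¬ (Borders n A i l ↔ Borders n A j l)
    · rw [(h₃ i hi j hj).1 hl]
      obtain ⟨l, hl, hl'⟩ := hl
      simpa using fun h : SameBorder n A i j => hl' (h l hl)
    · rw [(h₃ i hi j hj).2 hl]
      push Not at hl
      simpa using show SameBorder n A i j from hl
  · rintro s' hf' h'
    refine ⟨fun i hi j hj => ?_, h'⟩
    rw [hf' 1 (by decide), hf₃ 1 (by decide), hf₂ 1 (by decide), h₁ i hi j hj]
    split_ifs <;> simp [*]

open Classical in
theorem Solves.congr_weight {n : ℕ} {A : ℕ → ℕ → Prop} {W W' x : ℕ → ℕ} {K : ℕ}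
    (h : ∀ v < n, W v = W' v) : Solves n A W K x ↔ Solves n A W' K x := by
  have aux (p : ℕ → Prop) [DecidablePred p] : (∑ v ∈ Finset.range n, if p v then W v else 0) =
      ∑ v ∈ Finset.range n, if p v then W' v else 0 :=
    Finset.sum_congr rfl fun v hv => by rw [h v (Finset.mem_range.1 hv)]
  refine forall₂_congr fun a _ => ?_
  rw [aux, aux]

/-- The program that decides the weighted vertex integrity problem. -/
def decideIntegrity : Program := .seq readInput (.seq tables search)

open VertexIntegrity Classical in
theorem ends_decideIntegrity {n k L : ℕ} {g : List Bool} {l : List ℕ} {b : Bool}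
    (hg : g.length = n * n) (hl : l.length = n) {x : List Bool}
    (hx : x = List.replicate n true ++ false :: (g ++ (l.flatMap encodeNat ++ b :: encodeNat k)))
    (hL : x.length ≤ L) {A : ℕ → ℕ → Prop}
    (hA : ∀ i < n, ∀ j < n, A i j ↔ i = j ∨ g.getD (i * n + j) false = true)
    (hdiam : ∀ x : ℕ → ℕ, ∀ a < n, x a = 0 → ∀ v, Relation.ReflTransGen (Step n A x) a v →
      Within (Step n A x) a n v) :
    ∃ r, Represents (SameBorder n A) n r ∧ Ends decideIntegrity (Memory.init x)
      (readInputTime L + (tablesTime L + (1 +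
        (2 ^ Nat.count (fun i => ∀ j < i, ¬ SameBorder n A i j) n * (searchTime L + 2) + 2))))
      fun s' => s'.Accepting ↔ b = false ∧
        ∃ m < 2 ^ Nat.count (fun i => ∀ j < i, ¬ SameBorder n A i j) n,
          ∃ y, Decodes r m n y ∧ Solves n A (fun v => l.getD v 0) k y := by
  have hnL : n ≤ L := by
    have := congrArg List.length hx
    simp at this
    omega
  -- The witness r is the content of bank `12` after `tables`, which is known only inside the run.
  -- So r is first quantified in the postcondition and then extracted from the run.
  suffices h : Ends decideIntegrity (Memory.init x)
      (readInputTime L + (tablesTime L + (1 +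
        (2 ^ Nat.count (fun i => ∀ j < i, ¬ SameBorder n A i j) n * (searchTime L + 2) + 2))))
      fun s' => ∃ r, Represents (SameBorder n A) n r ∧ (s'.Accepting ↔ b = false ∧
        ∃ m < 2 ^ Nat.count (fun i => ∀ j < i, ¬ SameBorder n A i j) n,
          ∃ y, Decodes r m n y ∧ Solves n A (fun v => l.getD v 0) k y) by
    obtain ⟨t, s', h1, h2, r, h3, h4⟩ := h
    exact ⟨r, h3, t, s', h1, h2, h4⟩
  refine Ends.seq (ends_readInput hg hl hx hL) ?_
  rintro s₁ hf₁ ⟨i2, i4, i5, i7, i8⟩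
  have hrow : ∀ i < n, ∀ j < n, ∀ i' < n, ∀ j' < n, s₁ 4 i + j = s₁ 4 i' + j' →
      i = i' ∧ j = j' := by
    intro i hi j hj i' hi' j' hj' h
    rw [i4 i hi, i4 i' hi'] at h
    have hn : 0 < n := by omega
    have h' : j + n * i = j' + n * i' := by linarith
    have h1 := congrArg (· / n) h'
    have h2 := congrArg (· % n) h'
    simp only [Nat.add_mul_div_left _ _ hn, Nat.div_eq_of_lt hj, Nat.div_eq_of_lt hj', zero_add,
      Nat.add_mul_mod_self_left, Nat.mod_eq_of_lt hj, Nat.mod_eq_of_lt hj'] at h1 h2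
    exact ⟨h1, h2⟩
  refine Ends.seq (ends_tables (n := n) (A := A) i2 hnL hrow
    (fun a => by rw [hf₁ 10 (by decide)]; simp [Memory.init])
    (fun a => by rw [hf₁ 11 (by decide)]; simp [Memory.init])
    (fun a => by rw [hf₁ 12 (by decide)]; simp [Memory.init]) ?_) ?_
  · intro i hi j hj
    have hlt : i * n + j < g.length := by rw [hg]; nlinarith
    have hget : x.getD (n + 1 + i * n + j) false = g.getD (i * n + j) false := by
      have h1 : n + 1 + i * n + j = (List.replicate n true ++ [false]).length + (i * n + j) := by
        simp; omega
      have h2 : x = (List.replicate n true ++ [false]) ++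
        (g ++ (l.flatMap encodeNat ++ b :: encodeNat k)) := by simp [hx]
      rw [h2, h1, List.getD_eq_getElem?_getD, List.getD_eq_getElem?_getD,
        List.getElem?_append_right (by omega), Nat.add_sub_cancel_left,
        List.getElem?_append_left hlt]
    have hA' := hA i hi j hj
    rw [i4 i hi, hf₁ 1 (by decide)]
    by_cases hij : i = j
    · rw [if_pos hij, if_pos (hA'.2 (Or.inl hij))]
    · simp only [hij, false_or] at hA'
      rw [if_neg hij]
      simp only [hA', Memory.init, one_ne_zero, false_and, if_false, if_true, hget]
      cases g.getD (i * n + j) false <;> simp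
  · rintro s₂ hf₂ ⟨j1, j12, j13⟩
    refine (ends_search (n := n) (L := L) (A := A) (by rw [hf₂ 2 (by decide), i2]) hnL
      (by rw [hf₂ 4 (by decide)]; exact j1) hdiam ?_).mono (by rw [j13]) ?_
    · intro v hv
      rcases j12 v hv with h | ⟨j, hj, h, -⟩ <;> omega
    · intro s' _ h
      refine ⟨s₂ 12, j12, ?_⟩
      rw [Memory.Accepting, h, j13, hf₂ 7 (by decide), hf₂ 5 (by decide), hf₂ 8 (by decide), i7, i8]
      simp only [Solves.congr_weight i5, Bool.toNat_eq_zero]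

end RAM

/-! ### Components of G - S, separating sets and borders -/

namespace VertexIntegrity

/-- Vertices that are joined by a walk all of whose vertices, except for the first, are outside of
`S`. -/
def Joined {V : Type} (G : SimpleGraph V) (S : Finset V) : V → V → Prop :=
  Relation.ReflTransGen fun a b => G.Adj a b ∧ b ∉ S

open Classical in
/-- The vertices of the component of `s` in `G - S`; the empty set if `s` belongs to `S`. -/
noncomputable def reach {V : Type} [Fintype V] (G : SimpleGraph V) (S : Finset V) (s : V) :
    Finset V :=
  Finset.univ.filter fun v => s ∉ S ∧ Joined G S s v

section

variable {V : Type} {G : SimpleGraph V} {S : Finset V}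

theorem Joined.notMem {s v : V} (h : Joined G S s v) (hs : s ∉ S) : v ∉ S := by
  induction h with
  | refl => exact hs
  | tail _ h _ => exact h.2

theorem Joined.symm {s v : V} (h : Joined G S s v) (hs : s ∉ S) : Joined G S v s := by
  induction h with
  | refl => exact .refl
  | tail h h' ih => exact ih.head ⟨h'.1.symm, Joined.notMem h hs⟩

theorem joined_iff_reachable {s v : V} (hs : s ∉ S) :
    Joined G S s v ↔ ∃ hv : v ∉ S, (deleteSet G S).Reachable ⟨s, hs⟩ ⟨v, hv⟩ := by
  constructor
  · intro h
    induction h with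
    | refl => exact ⟨hs, .refl _⟩
    | tail _ h' ih =>
      obtain ⟨hv, h⟩ := ih
      refine ⟨h'.2, h.trans (SimpleGraph.Adj.reachable ?_)⟩
      simpa using h'.1
  · rintro ⟨hv, h⟩
    rw [SimpleGraph.reachable_iff_reflTransGen] at h
    exact h.lift Subtype.val fun a b hab => ⟨by simpa using hab, b.2⟩

theorem weight_mono {w : V → ℕ+} {X Y : Finset V} (h : X ⊆ Y) : weight w X ≤ weight w Y :=
  Finset.sum_le_sum_of_subset h

/-- The twin condition compares the neighbourhoods away from u and v; the edge between u and v
settles these two vertices. -/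
theorem Twins.closed_neighborhoods {u v : V} (h : Twins G u v) (huv : G.Adj u v) (l : V) :
    (u = l ∨ G.Adj u l) ↔ (v = l ∨ G.Adj v l) := by
  have hl := Set.ext_iff.1 h l
  simp only [Set.mem_sdiff, SimpleGraph.mem_neighborSet, Set.mem_singleton_iff] at hl
  by_cases h1 : u = l
  · subst h1; simp [huv.symm]
  by_cases h2 : v = l
  · subst h2; simp [huv]
  have h1' : l ≠ u := fun h => h1 h.symm
  have h2' : l ≠ v := fun h => h2 h.symm
  simpa [h1, h2, h1', h2'] using hl

/-- Each vertex of `S` has neighbours in different components of `G - S`. -/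
def Separating (G : SimpleGraph V) (S : Finset V) : Prop :=
  ∀ v ∈ S, ∃ x y, G.Adj v x ∧ G.Adj v y ∧ x ∉ S ∧ y ∉ S ∧ ¬ Joined G S x y

/-- The neighbours of `u` whose closed neighbourhood differs from the one of `u`. -/
def border (G : SimpleGraph V) (u : V) : Set V :=
  {x | (u = x ∨ G.Adj u x) ∧ ∃ l, ¬ ((u = l ∨ G.Adj u l) ↔ (x = l ∨ G.Adj x l))}

/-- Neighbours x, y of v in different components of G - S are not adjacent, so y witnesses N[x] ≠
N[v] and x witnesses N[y] ≠ N[v]. Both are thus in the common border, hence in N[u], and u outside S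
would connect them. -/
theorem Separating.mem_of_border_eq (hS : Separating G S) {u v : V} (hv : v ∈ S)
    (huv : border G u = border G v) : u ∈ S := by
  by_contra hu
  obtain ⟨x, y, hvx, hvy, hx, hy, hxy⟩ := hS v hv
  have hne : x ≠ y := fun h => hxy (h ▸ .refl)
  have hnadj : ¬ G.Adj x y := fun h => hxy (.single ⟨h, hy⟩)
  have hx' : x ∈ border G u := by
    rw [huv]
    exact ⟨Or.inr hvx, y, by simp [hvy, hne, hnadj]⟩
  have hy' : y ∈ border G u := by
    rw [huv]
    exact ⟨Or.inr hvy, x, by simp [hvx, hne.symm, G.adj_comm y x, hnadj]⟩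
  have h1 : Joined G S x u := by
    rcases hx'.1 with rfl | h
    exacts [.refl, .single ⟨h.symm, hu⟩]
  have h2 : Joined G S u y := by
    rcases hy'.1 with rfl | h
    exacts [.refl, .single ⟨h, hy⟩]
  exact hxy (h1.trans h2)

/-- A neighbour of v outside C is in the component of v in G - C, so it is an adjacent twin of v and
has the same closed neighbourhood. -/
theorem IsTwinCover.border_subset {C : Finset V} (hC : IsTwinCover G C) {v : V} (hv : v ∉ C) :
    border G v ⊆ C := by
  rintro x ⟨hvx, l, hl⟩
  by_contra hx
  have hx : x ∉ C := hx
  rcases hvx with rfl | hvx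
  · exact hl Iff.rfl
  · refine hl (Twins.closed_neighborhoods ?_ hvx l)
    refine hC ((deleteSet G C).connectedComponentMk ⟨v, hv⟩) ⟨v, hv⟩ rfl ⟨x, hx⟩ ?_
    rw [SimpleGraph.ConnectedComponent.mem_supp_iff, SimpleGraph.ConnectedComponent.eq]
    refine (SimpleGraph.Adj.reachable ?_).symm
    simpa using hvx

end

/-! ### Solutions can be made separating; the number of borders -/

section

variable {V : Type} [Fintype V] {G : SimpleGraph V} {w : V → ℕ+} {S : Finset V} {k : ℕ}

@[simp] theorem mem_reach {s v : V} : v ∈ reach G S s ↔ s ∉ S ∧ Joined G S s v := by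
  simp [reach]

theorem reach_of_mem {s : V} (hs : s ∈ S) : reach G S s = ∅ := by
  ext v
  simp [hs]

theorem reach_subset {s : V} {X : Finset V} (hs : s ∉ S → s ∈ X)
    (hX : ∀ a ∈ X, ∀ b ∉ S, G.Adj a b → b ∈ X) : reach G S s ⊆ X := by
  intro v hv
  rw [mem_reach] at hv
  obtain ⟨h0, h⟩ := hv
  induction h with
  | refl => exact hs h0
  | tail _ h' ih => exact hX _ ih _ h'.2 h'.1

theorem componentVertices_mk {s : V} (hs : s ∉ S) :
    componentVertices G S ((deleteSet G S).connectedComponentMk ⟨s, hs⟩) = reach G S s := by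
  ext v
  simp only [componentVertices, Finset.mem_filter, Finset.mem_univ, true_and, mem_reach, hs,
    not_false_eq_true, joined_iff_reachable hs, SimpleGraph.ConnectedComponent.mem_supp_iff,
    SimpleGraph.ConnectedComponent.eq]
  exact exists_congr fun _ => ⟨SimpleGraph.Reachable.symm, SimpleGraph.Reachable.symm⟩

/-- Deleting `S` leaves, together with the weight of `S`, at most `k` in each component. -/
def IsSolution (G : SimpleGraph V) (w : V → ℕ+) (k : ℕ) (S : Finset V) : Prop :=
  ∀ s, weight w S + weight w (reach G S s) ≤ k

/-- The maximum over components becomes a bound for all starting vertices; a start in S has empty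
reach and contributes just the weight of S. -/
theorem wvi_le_iff : wvi G w ≤ k ↔ ∃ S, IsSolution G w k S := by
  constructor
  · intro h
    obtain ⟨S, hS⟩ := exists_eq_ciInf_of_finite
      (f := fun S : Finset V => weight w S + maxComponentWeight G w S)
    refine ⟨S, fun s => le_trans ?_ (hS.trans_le h)⟩
    refine Nat.add_le_add_left ?_ _
    by_cases hs : s ∈ S
    · simp [reach_of_mem hs, weight]
    · rw [← componentVertices_mk hs]
      exact le_ciSup (f := fun C => weight w (componentVertices G S C))
        (Set.finite_range _).bddAbove _
  · rintro ⟨S, hS⟩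
    refine (ciInf_le (OrderBot.bddBelow _) S).trans ?_
    -- Without vertices `IsSolution` is vacuous and gives no bound on the weight of S, which is then
    -- 0 anyway.
    rcases isEmpty_or_nonempty V with hV | ⟨⟨s₀⟩⟩
    · have h1 : weight w S = 0 := by simp [weight, Finset.eq_empty_of_isEmpty S]
      have h2 : maxComponentWeight G w S ≤ 0 := by
        refine ciSup_le' fun C => ?_
        simp [weight, Finset.eq_empty_of_isEmpty (componentVertices G S C)]
      omega
    · have h1 := hS s₀
      have h2 : maxComponentWeight G w S ≤ k - weight w S := by
        refine ciSup_le' fun C => ?_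
        induction C using SimpleGraph.ConnectedComponent.ind with
        | _ s =>
          obtain ⟨s, hs⟩ := s
          have := hS s
          rw [← componentVertices_mk hs] at this
          omega
      omega

open Classical in
-- By `h`, the return of v does not merge components: at most one of them grows, and only by v. The
-- gain w(v) is paid for by the loss of v from S.
theorem IsSolution.erase {v : V} (hS : IsSolution G w k S) (hv : v ∈ S)
    (h : ∀ x y, G.Adj v x → G.Adj v y → x ∉ S → y ∉ S → Joined G S x y) :
    IsSolution G w k (S.erase v) := by
  intro s
  suffices h' : ∃ z, reach G (S.erase v) s ⊆ insert v (reach G S z) by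
    obtain ⟨z, hz⟩ := h'
    have h1 := weight_mono (w := w) hz
    have h2 : weight w (insert v (reach G S z)) ≤ w v + weight w (reach G S z) := by
      by_cases hvz : v ∈ reach G S z
      · rw [Finset.insert_eq_of_mem hvz]; omega
      · exact (Finset.sum_insert hvz).le
    have h3 : weight w (S.erase v) + w v = weight w S := Finset.sum_erase_add S _ hv
    have h4 := hS z
    omega
  have hb : ∀ b ∉ S.erase v, b = v ∨ b ∉ S := fun b hb => by
    by_contra! hc
    exact hb (Finset.mem_erase.2 hc)
  by_cases hsX : s = v ∨ ∃ x, G.Adj v x ∧ x ∉ S ∧ Joined G S x s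
  -- The case where s is v or is in a component next to v. Any neighbour of v outside S serves as z;
  -- if there is none, z = v serves, whose reach is empty because v is in S.
  · obtain ⟨z, hz, hsz⟩ : ∃ z, (∀ b, G.Adj v b → b ∉ S → b ∈ reach G S z) ∧
        s ∈ insert v (reach G S z) := by
      by_cases hx : ∃ x, G.Adj v x ∧ x ∉ S
      · obtain ⟨x, hvx, hxS⟩ := hx
        refine ⟨x, fun b hvb hbS => mem_reach.2 ⟨hxS, h x b hvx hvb hxS hbS⟩, ?_⟩
        rw [Finset.mem_insert, mem_reach]
        refine hsX.imp_right fun ⟨y, hvy, hyS, hys⟩ => ⟨hxS, ?_⟩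
        exact (h x y hvx hvy hxS hyS).trans hys
      · refine ⟨v, fun b hvb hbS => absurd ⟨b, hvb, hbS⟩ hx, ?_⟩
        rw [Finset.mem_insert]
        exact Or.inl (hsX.resolve_right fun ⟨x, hvx, hxS, _⟩ => hx ⟨x, hvx, hxS⟩)
    refine ⟨z, reach_subset (fun _ => hsz) fun a ha b hbS hab => ?_⟩
    rw [Finset.mem_insert] at ha ⊢
    refine (hb b hbS).imp_right fun hbS' => ?_
    rcases ha with rfl | ha
    · exact hz b hab hbS'
    · rw [mem_reach] at ha ⊢
      exact ⟨ha.1, ha.2.tail ⟨hab, hbS'⟩⟩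
  -- No neighbour of v outside S is joined to s, so the component of s does not change when v
  -- returns.
  · push Not at hsX
    refine ⟨s, (reach_subset (X := reach G S s) (fun hs => ?_) fun a ha b hbS hab => ?_).trans
      (Finset.subset_insert _ _)⟩
    · exact mem_reach.2 ⟨(hb s hs).resolve_left hsX.1, .refl⟩
    · rw [mem_reach] at ha ⊢
      rcases hb b hbS with rfl | hbS
      · exact absurd (ha.2.symm ha.1) (hsX.2 a hab.symm (ha.2.notMem ha.1))
      · exact ⟨ha.1, ha.2.tail ⟨hab, hbS⟩⟩

/-- A vertex that violates the separation property can be erased, and S shrinks each time. -/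
theorem IsSolution.exists_separating (hS : IsSolution G w k S) :
    ∃ S', IsSolution G w k S' ∧ Separating G S' := by
  classical
  induction S using Finset.strongInduction with
  | H S ih =>
    by_cases h : Separating G S
    · exact ⟨S, hS, h⟩
    · simp only [Separating] at h
      push Not at h
      obtain ⟨v, hv, h⟩ := h
      exact ih _ (Finset.erase_ssubset hv) (hS.erase hv h)

theorem exists_isTwinCover (G : SimpleGraph V) :
    ∃ C, IsTwinCover G C ∧ C.card = twinCoverNumber G :=
  Nat.sInf_mem (s := {m | ∃ C, IsTwinCover G C ∧ C.card = m})
    ⟨_, Finset.univ, fun _ u _ => absurd (Finset.mem_univ _) u.2, rfl⟩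

/-- Split X along a minimum twin cover C: the part in C has at most |C| elements, and the borders of
the others are different subsets of C. -/
theorem card_le_of_injOn_border (G : SimpleGraph V) {X : Finset V}
    (hX : Set.InjOn (border G) X) :
    X.card ≤ twinCoverNumber G + 2 ^ twinCoverNumber G := by
  classical
  obtain ⟨C, hC, hcard⟩ := exists_isTwinCover G
  have h1 : (X.filter (· ∈ C)).card ≤ C.card :=
    Finset.card_le_card fun v hv => (Finset.mem_filter.1 hv).2
  have h2 : (X.filter (· ∉ C)).card ≤ C.powerset.card := by
    refine Finset.card_le_card_of_injOn (fun v => C.filter (· ∈ border G v)) 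
      (fun v _ => Finset.mem_coe.2 (Finset.mem_powerset.2 (Finset.filter_subset (· ∈ border G v) C))) ?_
    intro u hu v hv huv
    rw [Finset.mem_coe, Finset.mem_filter] at hu hv
    refine hX hu.1 hv.1 (Set.ext fun x => ?_)
    have := Finset.ext_iff.1 huv x
    simp only [Finset.mem_filter, and_congr_right_iff] at this
    exact ⟨fun h => (this (hC.border_subset hu.2 h)).1 h,
      fun h => (this (hC.border_subset hv.2 h)).2 h⟩
  rw [Finset.card_powerset] at h2
  rw [← Finset.card_filter_add_card_filter_not (s := X) (· ∈ C), ← hcard]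
  omega

end

end VertexIntegrity

/-! ### Numbers as codes of unions of classes -/

namespace RAM

theorem Represents.le {R : ℕ → ℕ → Prop} {n : ℕ} {r : ℕ → ℕ} (h : Represents R n r) :
    ∀ v < n, r v ≤ v := by
  intro v hv
  rcases h v hv with h | ⟨j, hj, h, -⟩ <;> omega

open Classical in
theorem Represents.count_eq {R : ℕ → ℕ → Prop} {n : ℕ} {r : ℕ → ℕ} (h : Represents R n r) :
    Nat.count (fun i => r i = 0) n = Nat.count (fun i => ∀ j < i, ¬ R i j) n := by
  rw [Nat.count_eq_card_filter_range, Nat.count_eq_card_filter_range]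
  congr 1
  refine Finset.filter_congr fun i hi => ?_
  rcases h i (Finset.mem_range.1 hi) with h | ⟨j, hj, h, hR⟩
  · exact iff_of_true h.1 h.2
  · exact iff_of_false (by omega) fun h' => h' j hj hR

/-- The converse of decoding: the digits of m are the values of z at the representatives, in
increasing order. -/
theorem exists_decodes {r z : ℕ → ℕ} (hz : ∀ v, z v < 2) (n : ℕ)
    (hzr : ∀ v < n, r v ≠ 0 → z v = z (r v - 1)) :
    ∃ m < 2 ^ Nat.count (fun i => r i = 0) n, Decodes r m n z := by
  induction n with
  | zero => exact ⟨0, by simp, fun v hv => absurd hv (Nat.not_lt_zero v)⟩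
  | succ n ih =>
    obtain ⟨m, hm, hd⟩ := ih fun v hv => hzr v (by omega)
    by_cases hn : r n = 0
    -- The new representative n gets the digit just above those in use, so the earlier digits are
    -- not affected.
    · refine ⟨m + 2 ^ Nat.count (fun i => r i = 0) n * z n, ?_, fun v hv => ?_⟩
      · rw [Nat.count_succ, if_pos hn, pow_succ]
        have := Nat.mul_le_mul_left (2 ^ Nat.count (fun i => r i = 0) n) (Nat.le_of_lt_succ (hz n))
        omega
      · rcases Nat.lt_succ_iff_lt_or_eq.1 hv with hv | rfl
        · rw [hd v hv]
          split_ifs with h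
          · obtain ⟨d, hd⟩ := Nat.exists_eq_add_of_lt
              (Nat.count_strict_mono (p := fun i => r i = 0) h hv)
            rw [hd, add_assoc, pow_add, mul_assoc, Nat.add_mul_div_left _ _ (by positivity),
              pow_succ', mul_assoc, Nat.add_mul_mod_self_left]
          · rfl
        · rw [if_pos hn, Nat.add_mul_div_left _ _ (by positivity), Nat.div_eq_of_lt hm, zero_add,
            Nat.mod_eq_of_lt (hz v)]
    · refine ⟨m, by rwa [Nat.count_succ, if_neg hn], fun v hv => ?_⟩
      rcases Nat.lt_succ_iff_lt_or_eq.1 hv with hv | rfl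
      · exact hd v hv
      · rw [if_neg hn]
        exact hzr v (by omega) hn

theorem Within.mono {st : ℕ → ℕ → Prop} {a v r r' : ℕ} (h : Within st a r v) (hr : r ≤ r') :
    Within st a r' v := by
  induction hr with
  | refl => exact h
  | step _ ih => exact Or.inl ih

end RAM

/-! ### Translation between graphs on `Fin n` and relations on numbers -/

namespace VertexIntegrity

open RAM

section

variable {n : ℕ} {G : SimpleGraph (Fin n)}

/-- The closed neighbourhood relation of a graph on `Fin n`, on natural numbers. -/
def closedAdj (G : SimpleGraph (Fin n)) (i j : ℕ) : Prop :=
  i = j ∨ ∃ (hi : i < n) (hj : j < n), G.Adj ⟨i, hi⟩ ⟨j, hj⟩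

theorem closedAdj_coe {u v : Fin n} : closedAdj G u v ↔ u = v ∨ G.Adj u v := by
  simp [closedAdj, Fin.ext_iff]

theorem borders_coe {u v : Fin n} : Borders n (closedAdj G) u v ↔ v ∈ border G u := by
  simp only [Borders, border, Set.mem_ofPred_eq, ← closedAdj_coe]
  refine and_congr_right fun _ => ⟨?_, ?_⟩
  · rintro ⟨l, hl, h⟩
    exact ⟨⟨l, hl⟩, h⟩
  · rintro ⟨l, h⟩
    exact ⟨l, l.2, h⟩

theorem sameBorder_coe {u v : Fin n} :
    SameBorder n (closedAdj G) u v ↔ border G u = border G v := by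
  constructor
  · intro h
    ext x
    rw [← borders_coe, ← borders_coe]
    exact h x x.2
  · intro h l hl
    have := Set.ext_iff.1 h ⟨l, hl⟩
    rwa [← borders_coe, ← borders_coe] at this

open Classical in
-- The counted numbers are the least elements of the classes, so their borders are pairwise
-- different.
theorem count_sameBorder_le (G : SimpleGraph (Fin n)) :
    Nat.count (fun i => ∀ j < i, ¬ SameBorder n (closedAdj G) i j) n ≤
      twinCoverNumber G + 2 ^ twinCoverNumber G := by
  let X : Finset (Fin n) :=
    Finset.univ.filter fun v => ∀ j < (v : ℕ), ¬ SameBorder n (closedAdj G) v j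
  have hX : Set.InjOn (border G) X := by
    intro u hu v hv huv
    simp only [X, Finset.coe_filter, Finset.mem_univ, true_and, Set.mem_ofPred_eq] at hu hv
    rcases lt_trichotomy u v with h | h | h
    · exact absurd (sameBorder_coe.2 huv.symm) (hv u h)
    · exact h
    · exact absurd (sameBorder_coe.2 huv) (hu v h)
  refine le_trans ?_ (card_le_of_injOn_border G hX)
  rw [Nat.count_eq_card_filter_range, ← Finset.card_map Fin.valEmbedding]
  refine Finset.card_le_card fun i hi => ?_
  rw [Finset.mem_filter, Finset.mem_range] at hi
  exact Finset.mem_map.2 ⟨⟨i, hi.1⟩, by simpa [X] using hi.2, rfl⟩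

/-- The set of vertices at which `x` is nonzero. -/
def supportOf (n : ℕ) (x : ℕ → ℕ) : Finset (Fin n) := Finset.univ.filter fun v => x v ≠ 0

@[simp] theorem mem_supportOf {x : ℕ → ℕ} {v : Fin n} : v ∈ supportOf n x ↔ x v ≠ 0 := by
  simp [supportOf]

theorem reflTransGen_step_iff {x : ℕ → ℕ} {a v : Fin n} :
    Relation.ReflTransGen (Step n (closedAdj G) x) a v ↔ Joined G (supportOf n x) a v := by
  constructor
  · suffices h : ∀ b : ℕ, Relation.ReflTransGen (Step n (closedAdj G) x) a b →
        ∃ hb : b < n, Joined G (supportOf n x) a ⟨b, hb⟩ from fun h' => (h v h').2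
    intro b h
    induction h with
    | refl => exact ⟨a.2, .refl⟩
    | @tail b c _ h ih =>
      obtain ⟨hb, ih⟩ := ih
      obtain ⟨-, hc, h, hx⟩ := h
      refine ⟨hc, ?_⟩
      -- The relation is reflexive, so a step may stay in place; such a step adds nothing to the
      -- walk.
      rcases h with rfl | ⟨_, _, h⟩
      · exact ih
      · exact ih.tail ⟨h, by simpa using hx⟩
  · intro h
    unfold Joined at h
    refine h.lift Fin.val fun b c hbc => ?_
    exact ⟨b.2, c.2, closedAdj_coe.2 (Or.inr hbc.1), by simpa using hbc.2⟩

/-- Reachable vertices are joined by a path, and a path has fewer edges than there are vertices. -/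
theorem within_of_reflTransGen (x : ℕ → ℕ) (a : ℕ) (ha : a < n) (hxa : x a = 0) (v : ℕ)
    (h : Relation.ReflTransGen (Step n (closedAdj G) x) a v) :
    Within (Step n (closedAdj G) x) a n v := by
  have hv : v < n := by
    cases h with
    | refl => exact ha
    | tail _ h => exact h.2.1
  -- The walk runs backwards, from b to c: walks are extended at their start, `Within` is extended
  -- at its end.
  have key : ∀ {c b : {v // v ∉ supportOf n x}} (p : (deleteSet G (supportOf n x)).Walk b c),
      Within (Step n (closedAdj G) x) c p.length b := by
    intro c b p
    induction p with
    | nil => rfl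
    | @cons b d c hbd p ih =>
      refine Or.inr ⟨d, ih, d.1.2, b.1.2, closedAdj_coe.2 (Or.inr ?_), by simpa using b.2⟩
      exact G.adj_symm (by simpa using hbd)
  have h' : Joined G (supportOf n x) ⟨a, ha⟩ ⟨v, hv⟩ := reflTransGen_step_iff.1 h
  have ha' : (⟨a, ha⟩ : Fin n) ∉ supportOf n x := by simpa using hxa
  obtain ⟨hv', hr⟩ := (joined_iff_reachable ha').1 h'
  obtain ⟨p, hp⟩ := hr.symm.exists_isPath
  refine (key p).mono ?_
  have h1 := hp.length_lt
  have h2 := Fintype.card_subtype_le fun v : Fin n => v ∉ supportOf n x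
  rw [Fintype.card_fin] at h2
  omega

theorem solves_iff {x W : ℕ → ℕ} {w : Fin n → ℕ+} {k : ℕ} (hW : ∀ v : Fin n, W v = w v) :
    Solves n (closedAdj G) W k x ↔ IsSolution G w k (supportOf n x) := by
  classical
  have h1 : ∑ v ∈ Finset.range n, (if x v ≠ 0 then W v else 0) = weight w (supportOf n x) := by
    rw [Finset.sum_range, weight, supportOf, Finset.sum_filter]
    simp only [hW]
  have h2 : ∀ a : Fin n, ∑ v ∈ Finset.range n,
      (if x a = 0 ∧ Relation.ReflTransGen (Step n (closedAdj G) x) a v then W v else 0) =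
        weight w (reach G (supportOf n x) a) := by
    intro a
    rw [Finset.sum_range, weight, reach, Finset.sum_filter]
    simp only [hW, reflTransGen_step_iff, mem_supportOf, not_not]
  constructor
  · intro h a
    have := h a a.2
    rwa [← h1, ← h2]
  · intro h a ha
    have := h ⟨a, ha⟩
    rwa [← h1, ← h2] at this

open Classical in
/-- The sets that are tried suffice. -/
theorem exists_decodes_iff {r W : ℕ → ℕ} {w : Fin n → ℕ+} {k : ℕ}
    (hr : Represents (SameBorder n (closedAdj G)) n r) (hW : ∀ v : Fin n, W v = w v) :
    (∃ m < 2 ^ Nat.count (fun i => ∀ j < i, ¬ SameBorder n (closedAdj G) i j) n,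
      ∃ y, Decodes r m n y ∧ Solves n (closedAdj G) W k y) ↔ wvi G w ≤ k := by
  rw [wvi_le_iff]
  constructor
  · rintro ⟨m, -, y, -, h⟩
    exact ⟨_, (solves_iff hW).1 h⟩
  · rintro ⟨S, hS⟩
    -- Only a separating solution is constant on border classes, which is what makes its indicator
    -- function z encodable.
    obtain ⟨S, hS, hsep⟩ := hS.exists_separating
    let z : ℕ → ℕ := fun i => if ∃ h : i < n, ⟨i, h⟩ ∈ S then 1 else 0
    have hz : ∀ v : Fin n, z v = if v ∈ S then 1 else 0 := fun v => by simp [z]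
    have hzr : ∀ v < n, r v ≠ 0 → z v = z (r v - 1) := by
      intro v hv hrv
      rcases hr v hv with h | ⟨j, hj, h, hR⟩
      · exact absurd h.1 hrv
      · have hb := sameBorder_coe (u := ⟨v, hv⟩) (v := ⟨j, hj.trans hv⟩) |>.1 hR
        have h1 := hz ⟨v, hv⟩
        have h2 := hz ⟨j, hj.trans hv⟩
        simp only at h1 h2
        rw [h, Nat.add_sub_cancel, h1, h2]
        exact if_congr ⟨fun h => hsep.mem_of_border_eq h hb.symm,
          fun h => hsep.mem_of_border_eq h hb⟩ rfl rfl
    obtain ⟨m, hm, hd⟩ := exists_decodes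
      (fun v => by simp only [z]; split_ifs <;> decide) n hzr
    refine ⟨m, by rwa [← hr.count_eq], z, hd, (solves_iff hW).2 ?_⟩
    convert hS
    ext v
    simp [hz]

end

/-! ### The binary word of an instance -/

theorem getElem?_flatMap_of_length {α β : Type*} {n : ℕ} {f : α → List β}
    (hf : ∀ a, (f a).length = n) {j : ℕ} (hj : j < n) : ∀ (l : List α) (i : ℕ),
    (l.flatMap f)[i * n + j]? = l[i]?.bind fun a => (f a)[j]?
  | [], i => by simp
  | a :: l, 0 => by
    rw [List.flatMap_cons, List.getElem?_append_left (by rw [hf]; omega)]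
    simp
  | a :: l, i + 1 => by
    rw [List.flatMap_cons, List.getElem?_append_right (by rw [hf]; nlinarith), hf,
      show (i + 1) * n + j - n = i * n + j by rw [add_mul]; omega,
      getElem?_flatMap_of_length hf hj l i]
    simp

theorem length_encodeGraph {n : ℕ} (G : SimpleGraph (Fin n)) :
    (encodeGraph G).length = n * n := by
  simp [encodeGraph, List.length_flatMap]

theorem getD_encodeGraph {n : ℕ} (G : SimpleGraph (Fin n)) {i j : ℕ} (hi : i < n) (hj : j < n) :
    (encodeGraph G).getD (i * n + j) false = true ↔ G.Adj ⟨i, hi⟩ ⟨j, hj⟩ := by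
  rw [List.getD_eq_getElem?_getD, encodeGraph, getElem?_flatMap_of_length (by simp) hj]
  simp [hi, hj]

theorem encode_eq (x : Instance) : x.encode = List.replicate x.n true ++ false ::
    (encodeGraph x.graph ++ (((List.finRange x.n).map fun i => (x.w i : ℕ)).flatMap encodeNat ++
      decide (x.k < 0) :: encodeNat x.k.natAbs)) := by
  simp [Instance.encode, List.flatMap_map]

theorem isYes_iff (x : Instance) :
    x.IsYes ↔ decide (x.k < 0) = false ∧ wvi x.graph x.w ≤ x.k.natAbs := by
  rw [Instance.IsYes, decide_eq_false_iff_not]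
  omega

end VertexIntegrity

/-! ### The running time and the main theorem -/

theorem primrec_two_pow : Primrec fun c : ℕ => 2 ^ c := by
  refine (Primrec.nat_rec₁ (f := fun _ p => p + p) 1
    (Primrec.nat_add.comp Primrec.snd Primrec.snd)).of_eq fun c => ?_
  induction c with
  | zero => rfl
  | succ c ih => rw [pow_succ, mul_two, ← ih]

theorem computable_two_pow_add_two_pow : Computable fun c : ℕ => 2 ^ (c + 2 ^ c) :=
  (primrec_two_pow.comp (Primrec.nat_add.comp Primrec.id primrec_two_pow)).to_comp

open Polynomial in
-- This is the step bound of `ends_decideIntegrity` with the number of tried sets replaced by 1;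
-- that number becomes the parameter-dependent factor.
theorem exists_polynomial_time : ∃ p : Polynomial ℕ, ∀ L, p.eval L =
    RAM.readInputTime L + (RAM.tablesTime L + (1 + ((RAM.searchTime L + 2) + 2))) := by
  refine ⟨((X * 2 + 1) + (1 + ((X * ((1 + 1) + 2) + 2) +
    ((X * ((1 + (1 + ((X * 5 + 1) + 1))) + 1 + 2) + 2) +
      (1 + (1 + (1 + (1 + ((X * 5 + 1) + 1)))))))))
    + (((X * (1 + 2) + 2) + ((X * (X * (X * 4 + 4) + 4) + 2) + ((X * (X * (X * 4 + 4) + 4) + 2) +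
      (1 + (X * (X * 5 + 6) + 2))))) + (1 + ((((1 + (X * 5 + 2)) + ((1 + (X * 4 + 2)) +
      ((1 + (X * ((X * 3 + 2 + (2 + (X * (X * (X * 6 + 4) + 4) + 2))) +
      ((1 + (X * 4 + 2)) + 2) + 2) + 2)) + 2))) + 2) + 2))), fun L => ?_⟩
  simp [RAM.readInputTime, RAM.tablesTime, RAM.searchTime]

/-- Binary Weighted Vertex Integrity is fixed-parameter tractable parameterized by twin cover
number. -/
theorem mainTheorem10 :
    FixedParameterTractable VertexIntegrity.Instance.encode VertexIntegrity.Instance.IsYes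
      VertexIntegrity.Instance.tc := by
  classical
  obtain ⟨p, hp⟩ := exists_polynomial_time
  refine ⟨RAM.decideIntegrity, fun c => 2 ^ (c + 2 ^ c), p, computable_two_pow_add_two_pow,
    fun x => ?_⟩
  obtain ⟨r, hr, t, s, hrun, ht, hs⟩ := RAM.ends_decideIntegrity (L := x.encode.length)
    (VertexIntegrity.length_encodeGraph x.graph) (by simp) (VertexIntegrity.encode_eq x) le_rfl
    (A := VertexIntegrity.closedAdj x.graph)
    (fun i hi j hj => by
      rw [VertexIntegrity.getD_encodeGraph _ hi hj]
      exact or_congr_right ⟨fun ⟨_, _, h⟩ => h, fun h => ⟨hi, hj, h⟩⟩)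
    (fun y a ha hy v => VertexIntegrity.within_of_reflTransGen y a ha hy v)
  refine ⟨t, s, hrun, ht.trans ?_, ?_⟩
  · have h := Nat.pow_le_pow_right (n := 2) (by decide)
      (VertexIntegrity.count_sameBorder_le x.graph)
    rw [hp, VertexIntegrity.Instance.tc]
    refine le_trans ?_ (Nat.mul_le_mul_right _ h)
    -- The number of tried sets multiplies only the search term; as it is at least 1, it can be made
    -- a factor of all the other terms as well.
    have hF : 1 ≤ 2 ^ Nat.count (fun i => ∀ j < i,
      ¬ RAM.SameBorder x.n (VertexIntegrity.closedAdj x.graph) i j) x.n := Nat.one_le_two_pow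
    simp only [mul_add]
    gcongr <;> nlinarith
  · rw [hs, VertexIntegrity.isYes_iff]
    refine and_congr_right fun _ => VertexIntegrity.exists_decodes_iff hr fun v => ?_
    simp
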